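/- Let $K$ be a local field of positive characteristic $p$ (a locally compact, non-discrete, totally disconnected field of characteristic $p$) with absolute value $|\cdot|$, ring of integers $\mathcal O=\{x\in K:|x|\le 1\}$, prime ideal $\mathfrak P=\{x\in K:|x|<1\}$, a prime element $\mathfrak p$ (so $\mathfrak P=\mathfrak p\mathcal O$), and residue field $\mathcal O/\mathfrak P$ of order $q=p^c$; let $dx$ be the Haar measure of $K^+$ with $|\mathcal O|=1$. Fix $\epsilon_0=1,\epsilon_1,\dots,\epsilon_{c-1}\in\mathcal O\setminus\mathfrak P$ whose classes form a basis of $\mathcal O/\mathfrak P$ over $GF(p)$. For $n=\sum_k b_kq^k$ with $0\le b_k<q$ and $b_k=\sum_{i<c}a_{k,i}p^i$ with $0\le a_{k,i}<p$, put $u(n)=\sum_k\big(\sum_{i<c}a_{k,i}\epsilon_i\big)\mathfrak p^{-k-1}$, and let $\mathcal Z=\{u(n):n\ge 0\}$. Let $\chi$ be a continuous unitary character of $K^+$ that is trivial on $\mathcal O$, nontrivial on $\mathfrak p^{-1}\mathcal O$, and satisfies $\chi(u(k)u(l))=1$ for all $k,l\ge 0$. Let $\hat f$ denote the Fourier transform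 on $L^2(K)$, which extends $\hat f(\xi)=\int_K f(x)\chi(-\xi x)\,dx$, and put $T_kf(x)=f(x-u(k))$ and $D_{\mathfrak p}f(x)=q^{1/2}f(\mathfrak p^{-1}x)$. A $\mathcal Z$-TI space is a closed subspace $V\subseteq L^2(K)$ such that $T_kf\in V$ for all $f\in V$ and $k\ge 0$. Its multiplicity function is $m_V(\xi)=\dim J(\xi)\in\{0,1,2,\dots,\infty\}$ for a.e. $\xi\in\mathcal O$, where $J(\xi)\subseteq\ell^2$ is the closed linear span of the sequences $\big(\hat f(\xi+u(n))\big)_{n\ge0}$ with $f$ in a countable dense subset of $V$ (up to null sets, $J$ does not depend on that subset). Let $V$ be a $\mathcal Z$-TI space with $V\subseteq D_{\mathfrak p}(V)$, let $L\ge 0$ be an integer, and suppose that $m_V$ is integrable over $\mathcal O$ and satisfies $$m_V(\xi)+L=\sum_{d=0}^{q-1}m_V\big(\mathfrak p(\xi+u(d))\big)\qquad\text{for a.e. }\xi\in\mathcal O.$$ Then there are functions $\psi_1,\dots,\psi_L$ in $W=D_{\mathfrak p}(V)\ominus V$, the orthogonal complement of $V$ in $D_{\mathfrak p}(V)$, such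 that $\{\psi_l(\cdot-u(k)):k\ge 0,\ 1\le l\le L\}$ is an orthonormal basis of $W$. -/

import Mathlib

open MeasureTheory Filter Topology
open scoped ENNReal

namespace LFPC

/-- The ring of integers `𝒪 = {x : |x| ≤ 1}` of an ultrametric field, as a set. -/
def integers (K : Type*) [NontriviallyNormedField K] : Set K := {x | ‖x‖ ≤ 1}

/-- The translation parameter `u(n)` built from a prime element `π`, from representatives
`ε 0, …, ε (c-1)` of an `𝔽_p`-basis of the residue field, and from `q = p ^ c`: if
`n = ∑ₖ bₖ q ^ k` with `0 ≤ bₖ < q` and `bₖ = ∑ᵢ aₖᵢ p ^ i` with `0 ≤ aₖᵢ < p`, then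
`u(n) = ∑ₖ (∑ᵢ aₖᵢ εᵢ) π⁻¹ π ^ (-k)`.
The digits `bₖ` with `k > n` vanish, so that it is enough to sum over `k ≤ n`. -/
noncomputable def transl {K : Type*} [Field K] (p c : ℕ) (π : K) (ε : Fin c → K) (n : ℕ) : K :=
  ∑ k ∈ Finset.range (n + 1),
    (∑ i : Fin c, ((n / (p ^ c) ^ k % p ^ c / p ^ (i : ℕ) % p : ℕ) : K) * ε i) * π⁻¹ * π⁻¹ ^ k

/-- The choices that are fixed once and for all on a local field `K` of positive
characteristic. -/
structure Setting (K : Type*) [NontriviallyNormedField K] where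
  /-- the characteristic of `K` -/
  p : ℕ
  prime_p : p.Prime
  charP : CharP K p
  /-- the degree of the residue field over `𝔽_p` -/
  c : ℕ
  c_pos : 0 < c
  /-- a prime element: an element of largest absolute value in `𝔓 = {x : |x| < 1}` -/
  π : K
  norm_π_lt : ‖π‖ < 1
  le_norm_π : ∀ x : K, ‖x‖ < 1 → ‖x‖ ≤ ‖π‖
  /-- units whose classes form an `𝔽_p`-basis of `𝒪 / 𝔓` -/
  ε : Fin c → K
  ε_zero : ε ⟨0, c_pos⟩ = 1
  norm_ε : ∀ i, ‖ε i‖ = 1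
  /-- each class of `𝒪 / 𝔓` is a linear combination of the classes of the `ε i`, with
  coefficients in `𝔽_p = {0, …, p - 1}`, in exactly one way -/
  ε_basis : ∀ x : K, ‖x‖ ≤ 1 →
    ∃! a : Fin c → Fin p, ‖x - ∑ i, (((a i : Fin p) : ℕ) : K) * ε i‖ < 1
  /-- a continuous unitary character of the additive group of `K` -/
  χ : AddChar K Circle
  continuous_χ : Continuous χ
  /-- the character is trivial on `𝒪` … -/
  χ_integers : ∀ x : K, ‖x‖ ≤ 1 → χ x = 1
  /-- … but not on `𝔓⁻¹ = π⁻¹ 𝒪` … -/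
  χ_nontrivial : ∃ x : K, ‖π * x‖ ≤ 1 ∧ χ x ≠ 1
  /-- … and it is normalized with respect to the translations: `χ_{u(k)}(u(l)) = 1`. (This is a
  condition on the choice of `χ`; it does not follow from the two preceding ones.) -/
  χ_transl : ∀ k l : ℕ, χ (transl p c π ε k * transl p c π ε l) = 1

namespace Setting

variable {K : Type*} [NontriviallyNormedField K] (S : Setting K)

/-- The cardinality `q = p ^ c` of the residue field. -/
def q : ℕ := S.p ^ S.c

/-- The translation parameters `u(n)`. -/
noncomputable def u (n : ℕ) : K := transl S.p S.c S.π S.ε n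

lemma π_ne_zero : S.π ≠ 0 := by
  intro h
  obtain ⟨x, hx⟩ := NormedField.exists_one_lt_norm K
  have hx0 : x ≠ 0 := by
    rintro rfl
    simp only [norm_zero] at hx
    linarith
  have h1 : ‖x⁻¹‖ < 1 := by
    rw [norm_inv]
    exact inv_lt_one_of_one_lt₀ hx
  have h2 := S.le_norm_π _ h1
  rw [h, norm_zero] at h2
  exact inv_ne_zero hx0 (norm_le_zero_iff.mp h2)

end Setting

section Operators

variable {K : Type*} [NontriviallyNormedField K] [ProperSpace K]
  [MeasurableSpace K] [BorelSpace K] (S : Setting K) (μ : Measure K) [μ.IsAddHaarMeasure]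

/-- Translation `f ↦ f(· - a)` on `L²(K)`. -/
noncomputable def shift (a : K) : Lp ℂ 2 μ →ₗ[ℂ] Lp ℂ 2 μ :=
  (Lp.compMeasurePreservingₗ ℂ (fun x : K => x - a) (measurePreserving_sub_right μ a))

/-- `T_k f(x) = f(x - u(k))`. -/
noncomputable def T (k : ℕ) : Lp ℂ 2 μ →ₗ[ℂ] Lp ℂ 2 μ := shift μ (S.u k)

lemma exists_map_mul (a : K) (ha : a ≠ 0) :
    ∃ C : ℝ≥0∞, C ≠ ∞ ∧ μ.map (fun x => a * x) = C • μ := by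
  have h : (μ.map (fun x => a * x)).IsAddHaarMeasure :=
    (ContinuousLinearEquiv.unitsEquivAut K (Units.mk0 a ha)).toContinuousAddEquiv
      |>.isAddHaarMeasure_map μ |> fun h => by
        convert h using 2
        ext x
        simp [mul_comm]
  refine ⟨Measure.addHaarScalarFactor (μ.map (fun x => a * x)) μ, ENNReal.coe_ne_top, ?_⟩
  exact Measure.isAddLeftInvariant_eq_smul _ _

lemma quasi_mul (a : K) (ha : a ≠ 0) : Measure.QuasiMeasurePreserving (fun x => a * x) μ μ := by
  refine ⟨by fun_prop, ?_⟩
  obtain ⟨C, -, h⟩ := exists_map_mul μ a ha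
  rw [h]
  exact Measure.smul_absolutelyContinuous

lemma memLp_mul (a : K) (ha : a ≠ 0) (s : ℂ) (f : Lp ℂ 2 μ) :
    MemLp (fun x => s * f (a * x)) 2 μ := by
  obtain ⟨C, hC, h⟩ := exists_map_mul μ a ha
  have h1 : MemLp f 2 (μ.map (fun x => a * x)) := by
    rw [h]
    exact (Lp.memLp f).smul_measure hC
  exact (h1.comp_of_map (by fun_prop)).const_mul s

/-- The dilation `D f(x) = q ^ (1/2) f(π⁻¹ x)` on `L²(K)`. -/
noncomputable def D : Lp ℂ 2 μ →ₗ[ℂ] Lp ℂ 2 μ where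
  toFun f := (memLp_mul μ S.π⁻¹ (inv_ne_zero S.π_ne_zero) (Real.sqrt S.q : ℂ) f).toLp
  map_add' f g := by
    rw [← MemLp.toLp_add]
    refine MemLp.toLp_congr _ _ ?_
    filter_upwards [(quasi_mul μ S.π⁻¹ (inv_ne_zero S.π_ne_zero)).ae (Lp.coeFn_add f g)] with x hx
    simp only [Pi.add_apply] at hx ⊢
    rw [hx]
    ring
  map_smul' r f := by
    rw [RingHom.id_apply, ← MemLp.toLp_const_smul]
    refine MemLp.toLp_congr _ _ ?_
    filter_upwards [(quasi_mul μ S.π⁻¹ (inv_ne_zero S.π_ne_zero)).ae (Lp.coeFn_smul r f)] with x hx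
    simp only [Pi.smul_apply, smul_eq_mul] at hx ⊢
    rw [hx]
    ring

/-- The Fourier integral `∫ f(x) χ(-ξ x) dx`. -/
noncomputable def fourierIntegral (f : K → ℂ) (ξ : K) : ℂ :=
  ∫ x, f x * (S.χ (-(ξ * x)) : ℂ) ∂μ

/-- `g` is the Fourier transform of `f ∈ L²(K)`: the Fourier integrals of the restrictions of `f`
to the balls `𝔓⁻ⁿ = π⁻ⁿ 𝒪` (which belong to `L¹ ∩ L²`) converge to `g` in `L²(K)`. -/
def IsFourierTransform (f g : Lp ℂ 2 μ) : Prop :=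
  Tendsto (fun n : ℕ => eLpNorm
    (fun ξ => fourierIntegral S μ ({x : K | ‖S.π ^ n * x‖ ≤ 1}.indicator f) ξ - g ξ) 2 μ)
    atTop (𝓝 0)

/-- The Fourier transform on `L²(K)`: the unique `g` as above, which exists by Plancherel. -/
noncomputable def fourier (f : Lp ℂ 2 μ) : Lp ℂ 2 μ :=
  Classical.epsilon (IsFourierTransform S μ f)

open scoped Classical in
/-- The fiberization `𝒯 f(ξ) = (f̂(ξ + u(n)))_n`. It lies in `ℓ²` for almost every `ξ`, and is
set to be `0` for the other `ξ`. -/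
noncomputable def fiber (f : Lp ℂ 2 μ) (ξ : K) : lp (fun _ : ℕ => ℂ) 2 :=
  if h : Memℓp (fun n : ℕ => fourier S μ f (ξ + S.u n)) 2 then ⟨_, h⟩ else 0

/-- `L²(K)`, and with it each of its subspaces, is separable. -/
instance separableSpace_submodule (V : Submodule ℂ (Lp ℂ 2 μ)) :
    TopologicalSpace.SeparableSpace V := by
  have : Fact ((2 : ℝ≥0∞) ≠ ∞) := ⟨by simp⟩
  have : SecondCountableTopology (Lp ℂ 2 μ) := inferInstance
  infer_instance

/-- The range function of `V`: `J(ξ)` is the closed span of the fibers at `ξ` of the members of a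
countable dense subset of `V`. (The members of `L²` are classes of functions, and up to
null sets `J` does not depend on the countable dense subset or on the representatives.) -/
noncomputable def rangeFunction (V : Submodule ℂ (Lp ℂ 2 μ)) (ξ : K) :
    Submodule ℂ (lp (fun _ : ℕ => ℂ) 2) :=
  (Submodule.span ℂ (Set.range fun n : ℕ =>
    fiber S μ (TopologicalSpace.denseSeq V n : V) ξ)).topologicalClosure

/-- The multiplicity function `m_V(ξ) = dim J(ξ) ∈ ℕ ∪ {∞}`. -/
noncomputable def mult (V : Submodule ℂ (Lp ℂ 2 μ)) (ξ : K) : ℕ∞ :=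
  Cardinal.toENat (Module.rank ℂ (rangeFunction S μ V ξ))

/-- Integrability over `𝒪` of a function with values in `ℕ ∪ {∞}`. -/
def IntegrableOnIntegers (m : K → ℕ∞) : Prop :=
  AEMeasurable (fun ξ => (m ξ : ℝ≥0∞)) (μ.restrict (integers K)) ∧
    ∫⁻ ξ in integers K, (m ξ : ℝ≥0∞) ∂μ < ∞

/-- `V` is a translation invariant space under `𝒵 = {u(k)}`: a closed subspace of `L²(K)` with
`T_k f ∈ V` for all `f ∈ V` and all `k`. -/
structure IsTI (V : Submodule ℂ (Lp ℂ 2 μ)) : Prop where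
  isClosed : IsClosed (V : Set (Lp ℂ 2 μ))
  T_mem : ∀ f ∈ V, ∀ k : ℕ, T S μ k f ∈ V

/-- The dilated space `D(V)`. -/
noncomputable def dilate (V : Submodule ℂ (Lp ℂ 2 μ)) : Submodule ℂ (Lp ℂ 2 μ) :=
  V.map (D S μ)

/-- The orthogonal complement `D(V) ⊖ V` of `V` in `D(V)` (meant for `V ⊆ D(V)`). -/
noncomputable def waveletSpace (V : Submodule ℂ (Lp ℂ 2 μ)) : Submodule ℂ (Lp ℂ 2 μ) :=
  dilate S μ V ⊓ Vᗮ

end Operators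

end LFPC

set_option linter.unusedSectionVars false

/-! On the Fourier side, translation by `u(k)` becomes multiplication by `ξ ↦ χ(-u(k) ξ)`. Because
`χ(u(k) u(l)) = 1`, this factor is constant along each fiber `ξ + 𝒵`. A translation invariant space
thus acts like a field of closed subspaces `J(ξ)` of `ℓ²` over `ξ ∈ 𝒪`. The theorem is a dimension
count in the fibers, followed by a measurable choice of orthonormal frames.

Fiberwise linear algebra is done with the bracket `[f, g](ξ) = ∑ₙ conj f(ξ + u(n)) g(ξ + u(n))`. Its
Fourier coefficients on `𝒪` are the inner products of modulates of `f` with `g`. By completeness of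
the characters, it vanishes a.e. when `f ∈ X`, `g ∈ Xᗮ` and `X` is invariant
(`IsModInvariant.br_eq_zero`); conversely such vanishing puts `f` in `X`
(`IsModInvariant.mem_of_br`). The indicator of `u(n) + 𝒪` has the unit vector `e_n` as its fiber, so
its projection to `X` has fiber `P_ξ e_n`, and `∑ₙ ⟨P_ξ e_n, e_n⟩` is the trace of `P_ξ`.

Three facts about this trace are combined. It equals `m_V(ξ)` wherever that is finite
(`IsTI.hasSum_diagEntry`). It is additive over orthogonal differences
(`IsModInvariant.diagEntry_inf_orthogonal`). For the dilated space it is `∑_d m_V(π(ξ + u(d)))`,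
because `u(d + qn) = u(d) + π⁻¹ u(n)` splits the coordinates by residue modulo `q`
(`IsModInvariant.hasSum_diagEntry_map_freqDil`). The hypothesis on `m_V` therefore says that `W` has
trace `L` a.e.

An invariant space of constant trace `L` has `L` orthonormal generators
(`IsModInvariant.exists_generators`). If `L > 0`, some `P_ξ e_n` is nonzero; normalizing the first
such vector gives a `ψ` with unit fibers. Its modulates are orthonormal and span a space of trace
`1`, so passing to the orthogonal complement lowers `L` by one. Trace `0` forces the space to be
zero. -/

namespace LFPC

namespace Setting

/-! ### Arithmetic of the translation set `𝒵` -/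

section Algebra

variable {K : Type*} [NontriviallyNormedField K] (S : Setting K)

/-- The representative `∑ᵢ aᵢ εᵢ` of a residue class, where the `aᵢ` are the base `p` digits
of `b`. -/
noncomputable def rep (b : ℕ) : K :=
  ∑ i : Fin S.c, ((b / S.p ^ (i : ℕ) % S.p : ℕ) : K) * S.ε i

lemma rep_zero : S.rep 0 = 0 := by simp [rep]

lemma one_lt_q : 1 < S.q := Nat.one_lt_pow S.c_pos.ne' S.prime_p.one_lt

lemma q_pos : 0 < S.q := Nat.zero_lt_of_lt S.one_lt_q

lemma u_def (n : ℕ) :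
    S.u n = ∑ k ∈ Finset.range (n + 1), S.rep (n / S.q ^ k % S.q) * S.π⁻¹ * S.π⁻¹ ^ k := rfl

lemma u_eq_sum_range {n N : ℕ} (h : n < N) :
    S.u n = ∑ k ∈ Finset.range N, S.rep (n / S.q ^ k % S.q) * S.π⁻¹ * S.π⁻¹ ^ k := by
  rw [u_def]
  refine Finset.sum_subset (Finset.range_mono h) fun k _ hk => ?_
  have hk' : n < k := by simpa using hk
  rw [Nat.div_eq_of_lt (hk'.trans (Nat.lt_pow_self S.one_lt_q)), Nat.zero_mod, rep_zero]
  ring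

lemma u_zero : S.u 0 = 0 := by simp [u_def, rep_zero]

/-- Splitting off the lowest base `q` digit. This recursion replaces the digit sum in the inductions
below. -/
lemma u_rec (n : ℕ) : S.u n = S.π⁻¹ * (S.rep (n % S.q) + S.u (n / S.q)) := by
  rcases Nat.eq_zero_or_pos n with rfl | hn
  · simp [u_zero, rep_zero]
  · rw [u_def, Finset.sum_range_succ', S.u_eq_sum_range (Nat.div_lt_self hn S.one_lt_q), mul_add,
      Finset.mul_sum, add_comm]
    congr 1
    · simp [mul_comm]
    · refine Finset.sum_congr rfl fun k _ => ?_
      rw [Nat.div_div_eq_div_mul, ← pow_succ']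
      ring

/-- The self-similarity of `𝒵` that governs dilation: the index map `n ↦ d + qn` is scaling by `π⁻¹`
followed by a shift. -/
lemma u_add_mul {d : ℕ} (hd : d < S.q) (n : ℕ) :
    S.u (d + S.q * n) = S.u d + S.π⁻¹ * S.u n := by
  rw [S.u_rec (d + S.q * n), S.u_rec d, Nat.add_mul_mod_self_left, Nat.mod_eq_of_lt hd,
    Nat.add_mul_div_left _ _ S.q_pos, Nat.div_eq_of_lt hd, u_zero]
  simp [mul_add]

/-- Base `p` digits identify the numbers below `q` with the functions `Fin c → Fin p`. -/
noncomputable def digits : (Fin S.c → Fin S.p) ≃ Fin S.q := finFunctionFinEquiv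

lemma rep_digits (a : Fin S.c → Fin S.p) :
    S.rep (S.digits a) = ∑ i, (((a i : Fin S.p) : ℕ) : K) * S.ε i := by
  obtain ⟨b, rfl⟩ := S.digits.symm.surjective a
  rw [Equiv.apply_symm_apply]
  rfl

lemma rep_eq {d : ℕ} (hd : d < S.q) :
    S.rep d = ∑ i, (((S.digits.symm ⟨d, hd⟩ i : Fin S.p) : ℕ) : K) * S.ε i := rfl

lemma exists_rep {x : K} (hx : ‖x‖ ≤ 1) : ∃ d < S.q, ‖x - S.rep d‖ < 1 := by
  obtain ⟨a, ha, -⟩ := S.ε_basis x hx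
  exact ⟨S.digits a, (S.digits a).2, by simpa only [rep_digits] using ha⟩

lemma cast_mod (a : ℕ) : ((a % S.p : ℕ) : K) = a := by
  have := S.charP
  exact (CharP.natCast_eq_natCast_mod K S.p a).symm

/-- In characteristic `p` the base `p` digits add modulo `p` with no carry. This is why `𝒵` is a
group. -/
lemma exists_rep_add (d e : ℕ) : ∃ f < S.q, S.rep d + S.rep e = S.rep f := by
  have hp := S.prime_p.pos
  let a : Fin S.c → Fin S.p := fun i =>
    ⟨(d / S.p ^ (i : ℕ) + e / S.p ^ (i : ℕ)) % S.p, Nat.mod_lt _ hp⟩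
  refine ⟨S.digits a, (S.digits a).2, ?_⟩
  rw [rep_digits, rep, rep, ← Finset.sum_add_distrib]
  refine Finset.sum_congr rfl fun i _ => ?_
  simp only [a, cast_mod]
  push_cast
  ring

lemma exists_u_add (n m : ℕ) : ∃ k, S.u n + S.u m = S.u k := by
  induction n using Nat.strong_induction_on generalizing m with
  | _ n ih =>
    rcases Nat.eq_zero_or_pos n with rfl | hn
    · exact ⟨m, by simp [u_zero]⟩
    · obtain ⟨k, hk⟩ := ih (n / S.q) (Nat.div_lt_self hn S.one_lt_q) (m / S.q)
      obtain ⟨f, hf, hf'⟩ := S.exists_rep_add (n % S.q) (m % S.q)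
      refine ⟨f + S.q * k, ?_⟩
      rw [S.u_rec n, S.u_rec m, S.u_rec (f + S.q * k), Nat.add_mul_mod_self_left,
        Nat.mod_eq_of_lt hf, Nat.add_mul_div_left _ _ S.q_pos, Nat.div_eq_of_lt hf, zero_add, ← hk,
        ← hf']
      ring

lemma exists_u_nsmul (a n : ℕ) : ∃ k, a • S.u n = S.u k := by
  induction a with
  | zero => exact ⟨0, by simp [u_zero]⟩
  | succ a ih =>
    obtain ⟨k, hk⟩ := ih
    rw [succ_nsmul, hk]
    exact S.exists_u_add k n

lemma exists_u_neg (n : ℕ) : ∃ k, -S.u n = S.u k := by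
  obtain ⟨k, hk⟩ := S.exists_u_nsmul (S.p - 1) n
  refine ⟨k, ?_⟩
  have := S.charP
  rw [← hk, nsmul_eq_mul, Nat.cast_sub S.prime_p.one_le, CharP.cast_eq_zero]
  simp

lemma exists_u_sub (n m : ℕ) : ∃ k, S.u n - S.u m = S.u k := by
  obtain ⟨k, hk⟩ := S.exists_u_neg m
  rw [sub_eq_add_neg, hk]
  exact S.exists_u_add n k

lemma χ_u_mul_u (k l : ℕ) : S.χ (S.u k * S.u l) = 1 := S.χ_transl k l

lemma χ_u_mul_add (k l : ℕ) (x : K) : S.χ (S.u k * (x + S.u l)) = S.χ (S.u k * x) := by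
  rw [mul_add, AddChar.map_add_eq_mul, χ_u_mul_u, mul_one]

lemma norm_π_pos : 0 < ‖S.π‖ := norm_pos_iff.mpr S.π_ne_zero

/-- By maximality of `‖π‖` below `1`, the ideal `a𝒪` contains `π⁻¹𝒪`, where `χ` is nontrivial. -/
lemma exists_χ_mul_ne_one {a : K} (ha : 1 < ‖a‖) : ∃ x : K, ‖x‖ ≤ 1 ∧ S.χ (a * x) ≠ 1 := by
  obtain ⟨x, hx, hx'⟩ := S.χ_nontrivial
  have ha0 : a ≠ 0 := norm_pos_iff.mp (zero_lt_one.trans ha)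
  refine ⟨a⁻¹ * x, ?_, by rwa [mul_inv_cancel_left₀ ha0]⟩
  have h1 : ‖a⁻¹‖ ≤ ‖S.π‖ := S.le_norm_π _ (by rw [norm_inv]; exact inv_lt_one_of_one_lt₀ ha)
  calc ‖a⁻¹ * x‖ = ‖a⁻¹‖ * ‖x‖ := norm_mul _ _
    _ ≤ ‖S.π‖ * ‖x‖ := by gcongr
    _ ≤ 1 := by rwa [← norm_mul]

/-- If `u(n)` approximates `πx` with error in `𝒪`, and `d` is the digit of that error modulo `𝔓`,
then `u(d + qn)` approximates `x`. The bound on the index serves, for `N = 1`, to list the cosets of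
`𝒪` in `π⁻¹𝒪`. -/
lemma exists_norm_sub_u_le_of_pow (N : ℕ) {x : K} (hx : ‖S.π ^ N * x‖ ≤ 1) :
    ∃ n < S.q ^ N, ‖x - S.u n‖ ≤ 1 := by
  induction N generalizing x with
  | zero => exact ⟨0, by simp, by simpa [u_zero] using hx⟩
  | succ N ih =>
    obtain ⟨n, hn, hn'⟩ := ih (x := S.π * x) (by rwa [← mul_assoc, ← pow_succ])
    obtain ⟨d, hd, hd'⟩ := S.exists_rep hn'
    refine ⟨d + S.q * n, ?_, ?_⟩
    · calc d + S.q * n < S.q + S.q * n := by omega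
        _ = S.q * (n + 1) := by ring
        _ ≤ S.q * S.q ^ N := by gcongr; omega
        _ = S.q ^ (N + 1) := by ring
    · have h1 : x - S.u (d + S.q * n) = S.π⁻¹ * (S.π * x - S.u n - S.rep d) := by
        rw [S.u_add_mul hd, S.u_rec d, Nat.mod_eq_of_lt hd, Nat.div_eq_of_lt hd, u_zero]
        field_simp [S.π_ne_zero]
        ring
      rw [h1, norm_mul, norm_inv, inv_mul_le_iff₀ S.norm_π_pos, mul_one]
      exact S.le_norm_π _ hd'

lemma exists_pow_mul_le (x : K) : ∃ N, ∀ M ≥ N, ‖S.π ^ M * x‖ ≤ 1 := by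
  have h : Tendsto (fun M : ℕ => ‖S.π ^ M * x‖) atTop (𝓝 0) := by
    simp only [norm_mul, norm_pow]
    simpa using (tendsto_pow_atTop_nhds_zero_of_lt_one (norm_nonneg _) S.norm_π_lt).mul_const ‖x‖
  exact eventually_atTop.mp (h.eventually_le_const zero_lt_one)

lemma exists_norm_sub_u_le (x : K) : ∃ n, ‖x - S.u n‖ ≤ 1 := by
  obtain ⟨N, hN⟩ := S.exists_pow_mul_le x
  obtain ⟨n, -, hn⟩ := S.exists_norm_sub_u_le_of_pow N (hN N le_rfl)
  exact ⟨n, hn⟩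

/-- The characters `χ_{u(k)}` separate the points of `𝒪`. -/
lemma exists_χ_u_mul_ne_one {z : K} (hz : ‖z‖ ≤ 1) (hz0 : z ≠ 0) :
    ∃ k, S.χ (S.u k * z) ≠ 1 := by
  obtain ⟨x, -, hx⟩ := S.χ_nontrivial
  -- Approximating `x / z` makes `u(k) z` congruent to `x` modulo `𝒪`, where `χ` is trivial.
  obtain ⟨k, hk⟩ := S.exists_norm_sub_u_le (x * z⁻¹)
  refine ⟨k, fun h => hx ?_⟩
  have h1 : x = (x * z⁻¹ - S.u k) * z + S.u k * z := by field_simp; ring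
  rw [h1, AddChar.map_add_eq_mul, h, mul_one]
  refine S.χ_integers _ ?_
  rw [norm_mul]
  exact mul_le_one₀ hk (norm_nonneg _) hz

variable [IsUltrametricDist K]

lemma norm_rep_le (b : ℕ) : ‖S.rep b‖ ≤ 1 := by
  refine IsUltrametricDist.norm_sum_le_of_forall_le_of_nonneg zero_le_one fun i _ => ?_
  rw [norm_mul, S.norm_ε, mul_one]
  exact IsUltrametricDist.norm_natCast_le_one K _

lemma rep_injOn {d e : ℕ} (hd : d < S.q) (he : e < S.q) (h : ‖S.rep d - S.rep e‖ < 1) :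
    d = e := by
  have h1 := (S.ε_basis (S.rep d) (S.norm_rep_le d)).unique
    (y₁ := S.digits.symm ⟨d, hd⟩) (y₂ := S.digits.symm ⟨e, he⟩)
    (by rw [← S.rep_eq hd]; simp) (by rwa [← S.rep_eq he])
  simpa using S.digits.symm.injective h1

lemma norm_add_le_one {x y : K} (hx : ‖x‖ ≤ 1) (hy : ‖y‖ ≤ 1) : ‖x + y‖ ≤ 1 :=
  (IsUltrametricDist.norm_add_le_max x y).trans (max_le hx hy)

lemma norm_sub_le_one {x y : K} (hx : ‖x‖ ≤ 1) (hy : ‖y‖ ≤ 1) : ‖x - y‖ ≤ 1 := by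
  rw [sub_eq_add_neg]
  exact norm_add_le_one hx (by rwa [norm_neg])

/-- Multiplication by `π` turns the difference into a difference of lowest digits plus `u(n / q) -
u(m / q)`. The digits are integral, so the second difference is too, and the higher digits agree by
induction. What remains is a difference of digits lying in `𝔓`. -/
lemma eq_of_norm_u_sub_le (n m : ℕ) (h : ‖S.u n - S.u m‖ ≤ 1) : n = m := by
  induction hN : n + m using Nat.strong_induction_on generalizing n m with
  | _ N ih =>
    rcases Nat.eq_zero_or_pos N with h0 | hpos
    · omega
    have h1 : ‖(S.rep (n % S.q) - S.rep (m % S.q)) + (S.u (n / S.q) - S.u (m / S.q))‖ < 1 := by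
      refine lt_of_le_of_lt ?_ S.norm_π_lt
      have : (S.rep (n % S.q) - S.rep (m % S.q)) + (S.u (n / S.q) - S.u (m / S.q)) =
          S.π * (S.u n - S.u m) := by
        rw [S.u_rec n, S.u_rec m]
        field_simp [S.π_ne_zero]
        ring
      rw [this, norm_mul]
      exact mul_le_of_le_one_right (norm_nonneg _) h
    have h2 : ‖S.u (n / S.q) - S.u (m / S.q)‖ ≤ 1 := by
      have := norm_sub_le_one h1.le
        (norm_sub_le_one (S.norm_rep_le (n % S.q)) (S.norm_rep_le (m % S.q)))
      simpa using this
    have hlt : n / S.q + m / S.q < N := by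
      rcases Nat.eq_zero_or_pos n with rfl | hn
      · have := Nat.div_lt_self (n := m) (by omega) S.one_lt_q
        simp only [Nat.zero_div]
        omega
      · have := Nat.div_lt_self hn S.one_lt_q
        have := Nat.div_le_self m S.q
        omega
    have h3 := ih _ hlt _ _ h2 rfl
    rw [h3, sub_self, add_zero] at h1
    have h4 := S.rep_injOn (Nat.mod_lt _ S.q_pos) (Nat.mod_lt _ S.q_pos) h1
    rw [← Nat.mod_add_div n S.q, ← Nat.mod_add_div m S.q, h3, h4]

lemma u_injective : Function.Injective S.u := fun n m h =>
  S.eq_of_norm_u_sub_le n m (by simp [h])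

lemma one_lt_norm_u_sub {n m : ℕ} (h : n ≠ m) : 1 < ‖S.u n - S.u m‖ := by
  by_contra! h'
  exact h (S.eq_of_norm_u_sub_le n m h')

lemma norm_π_mul_u_le {d : ℕ} (hd : d < S.q) : ‖S.π * S.u d‖ ≤ 1 := by
  rw [S.u_rec d, Nat.mod_eq_of_lt hd, Nat.div_eq_of_lt hd, u_zero, add_zero,
    mul_inv_cancel_left₀ S.π_ne_zero]
  exact S.norm_rep_le d

/-- Adding `u n` permutes the set of all translation parameters. -/
lemma exists_equiv_u_add (n : ℕ) : ∃ e : ℕ ≃ ℕ, ∀ m, S.u (e m) = S.u m + S.u n := by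
  choose f hf using fun m => S.exists_u_add m n
  choose g hg using fun m => S.exists_u_sub m n
  refine ⟨⟨f, g, fun m => S.u_injective ?_, fun m => S.u_injective ?_⟩, fun m => (hf m).symm⟩
  · rw [← hg, ← hf]; ring
  · rw [← hf, ← hg]; ring

end Algebra

end Setting

/-! ### Completeness of the characters on `𝒪` -/

/-- An integrable function on a compact metric space is null if it is orthogonal to all
continuous functions. -/
lemma ae_eq_zero_of_integral_continuousMap_mul {X : Type*} [PseudoMetricSpace X] [CompactSpace X]
    [MeasurableSpace X] [BorelSpace X] {ν : Measure X} [IsFiniteMeasure ν] {h : X → ℂ}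
    (hi : Integrable h ν) (h0 : ∀ φ : C(X, ℂ), ∫ x, φ x * h x ∂ν = 0) : h =ᵐ[ν] 0 := by
  -- Closed sets suffice, and their indicators are bounded pointwise limits of continuous functions.
  refine ae_eq_zero_of_forall_setIntegral_isClosed_eq_zero hi fun s hs => ?_
  have hδ : ∀ n : ℕ, (0 : ℝ) < 1 / ((n : ℝ) + 1) := fun n => Nat.one_div_pos_of_nat
  have hlim := thickenedIndicator_tendsto_indicator_closure hδ tendsto_one_div_add_atTop_nhds_zero_nat s
  rw [hs.closure_eq, tendsto_pi_nhds] at hlim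
  have h1 : Tendsto (fun n : ℕ => ∫ x, ((thickenedIndicator (hδ n) s x : ℝ) : ℂ) * h x ∂ν) atTop
      (𝓝 (∫ x, s.indicator h x ∂ν)) := by
    refine tendsto_integral_of_dominated_convergence (fun x => ‖h x‖) (fun n => ?_) hi.norm
      (fun n => ?_) ?_
    · refine AEStronglyMeasurable.mul ?_ hi.1
      have : Continuous fun x => ((thickenedIndicator (hδ n) s x : ℝ) : ℂ) := by fun_prop
      exact this.aestronglyMeasurable
    · refine Eventually.of_forall fun x => ?_
      rw [norm_mul]
      refine mul_le_of_le_one_left (norm_nonneg _) ?_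
      rw [Complex.norm_real, Real.norm_of_nonneg (NNReal.coe_nonneg _)]
      exact_mod_cast thickenedIndicator_le_one (hδ n) s x
    · refine Eventually.of_forall fun x => ?_
      have h2 : Tendsto (fun n : ℕ => ((thickenedIndicator (hδ n) s x : ℝ) : ℂ)) atTop
          (𝓝 (((s.indicator (fun _ => (1 : NNReal)) x : NNReal) : ℝ) : ℂ)) :=
        (Complex.continuous_ofReal.tendsto _).comp
          ((NNReal.continuous_coe.tendsto _).comp (hlim x))
      convert h2.mul_const (h x) using 2
      by_cases hx : x ∈ s <;> simp [hx]
  rw [← integral_indicator hs.measurableSet]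
  refine tendsto_nhds_unique h1 ?_
  have h2 : ∀ n : ℕ, ∫ x, ((thickenedIndicator (hδ n) s x : ℝ) : ℂ) * h x ∂ν = 0 := fun n =>
    h0 ⟨fun x => ((thickenedIndicator (hδ n) s x : ℝ) : ℂ), by fun_prop⟩
  simp only [h2]
  exact tendsto_const_nhds

section Characters

variable {K : Type*} [NontriviallyNormedField K] (S : Setting K)

lemma integers_eq : integers K = Metric.closedBall 0 1 := by ext; simp [integers]

lemma measurableSet_integers [MeasurableSpace K] [BorelSpace K] :
    MeasurableSet (integers K) := by
  rw [integers_eq]; exact measurableSet_closedBall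

lemma isCompact_integers [ProperSpace K] : IsCompact (integers K) := by
  rw [integers_eq]; exact isCompact_closedBall _ _

instance [ProperSpace K] : CompactSpace (integers K) :=
  isCompact_iff_compactSpace.mp isCompact_integers

/-- The character `x ↦ χ(u(k) x)` on `𝒪`. -/
noncomputable def charMap (k : ℕ) : C(integers K, ℂ) where
  toFun x := (S.χ (S.u k * x) : ℂ)
  continuous_toFun := continuous_induced_dom.comp (S.continuous_χ.comp (by fun_prop))

/-- The algebra of trigonometric polynomials on `𝒪`. -/
noncomputable def charSubalgebra : StarSubalgebra ℂ C(integers K, ℂ) where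
  toSubalgebra := Algebra.adjoin ℂ (Set.range (charMap S))
  star_mem' := by
    change Algebra.adjoin ℂ (Set.range (charMap S)) ≤
      star (Algebra.adjoin ℂ (Set.range (charMap S)))
    refine Algebra.adjoin_le ?_
    rintro - ⟨n, rfl⟩
    obtain ⟨k, hk⟩ := S.exists_u_neg n
    refine Algebra.subset_adjoin ⟨k, ?_⟩
    ext x
    simp [charMap, ← hk, AddChar.map_neg_eq_inv, ← Circle.coe_inv_eq_conj]

/-- A product of characters is again a character of this family since `𝒵` is closed under addition,
so generating an algebra adds nothing to the linear span. -/
lemma charSubalgebra_coe :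
    Subalgebra.toSubmodule (charSubalgebra S).toSubalgebra =
      Submodule.span ℂ (Set.range (charMap S)) := by
  apply Algebra.adjoin_eq_span_of_subset
  refine Set.Subset.trans ?_ Submodule.subset_span
  intro x hx
  refine Submonoid.closure_induction (fun _ => id) ⟨0, ?_⟩ ?_ hx
  · ext x
    simp [charMap, S.u_zero]
  · rintro - - - - ⟨m, rfl⟩ ⟨n, rfl⟩
    obtain ⟨k, hk⟩ := S.exists_u_add m n
    refine ⟨k, ?_⟩
    ext x
    simp [charMap, ← hk, add_mul, AddChar.map_add_eq_mul]

variable [IsUltrametricDist K]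

lemma charSubalgebra_separatesPoints : (charSubalgebra S).SeparatesPoints := by
  intro x y hxy
  have hz : (x : K) - y ≠ 0 := sub_ne_zero.mpr (Subtype.coe_injective.ne hxy)
  obtain ⟨k, hk⟩ := S.exists_χ_u_mul_ne_one (Setting.norm_sub_le_one x.2 y.2) hz
  refine ⟨_, ⟨charMap S k, Algebra.subset_adjoin ⟨k, rfl⟩, rfl⟩, fun h => hk ?_⟩
  have h' : S.χ (S.u k * x) = S.χ (S.u k * y) := Circle.ext h
  rw [mul_sub, AddChar.map_sub_eq_div, h', div_self']

variable [ProperSpace K]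

lemma span_charMap_closure_eq_top :
    (Submodule.span ℂ (Set.range (charMap S))).topologicalClosure = ⊤ := by
  rw [← charSubalgebra_coe]
  exact congr_arg (Subalgebra.toSubmodule <| StarSubalgebra.toSubalgebra ·)
    (ContinuousMap.starSubalgebra_topologicalClosure_eq_top_of_separatesPoints _
      (charSubalgebra_separatesPoints S))

variable [MeasurableSpace K] [BorelSpace K]

/-- The functional `φ ↦ ∫ φ h` is continuous for the sup norm and vanishes on the trigonometric
polynomials, which are dense by Stone–Weierstrass. -/
lemma ae_eq_zero_of_integral_charMap_mul {ν : Measure (integers K)} [IsFiniteMeasure ν]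
    {h : integers K → ℂ} (hi : Integrable h ν)
    (h0 : ∀ k, ∫ x, charMap S k x * h x ∂ν = 0) : h =ᵐ[ν] 0 := by
  have hφi : ∀ φ : C(integers K, ℂ), Integrable (fun x => φ x * h x) ν := fun φ =>
    hi.bdd_mul (c := ‖φ‖) φ.continuous.aestronglyMeasurable
      (Eventually.of_forall φ.norm_coe_le_norm)
  let Λ : C(integers K, ℂ) →L[ℂ] ℂ := LinearMap.mkContinuous
    { toFun := fun φ => ∫ x, φ x * h x ∂ν
      map_add' := fun φ ψ => by
        rw [← integral_add (hφi φ) (hφi ψ)]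
        simp [add_mul]
      map_smul' := fun r φ => by
        rw [RingHom.id_apply, smul_eq_mul, ← integral_const_mul]
        simp [mul_assoc] } (∫ x, ‖h x‖ ∂ν) fun φ => by
      refine (norm_integral_le_integral_norm _).trans ?_
      rw [← integral_mul_const]
      refine integral_mono (hφi φ).norm (hi.norm.mul_const _) fun x => ?_
      simp only [norm_mul]
      rw [mul_comm]
      gcongr
      exact φ.norm_coe_le_norm x
  have hΛ : Λ = 0 := by
    refine ContinuousLinearMap.ext_on (s := Set.range (charMap S)) ?_ ?_
    · rw [Submodule.dense_iff_topologicalClosure_eq_top]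
      exact span_charMap_closure_eq_top S
    · rintro _ ⟨k, rfl⟩
      exact h0 k
  exact ae_eq_zero_of_integral_continuousMap_mul hi fun φ => DFunLike.congr_fun hΛ φ

variable (μ : Measure K)

/-- An integrable function on `𝒪` all of whose Fourier coefficients vanish is null. -/
lemma ae_eq_zero_of_setIntegral_χ_mul [IsFiniteMeasureOnCompacts μ] {h : K → ℂ}
    (hi : IntegrableOn h (integers K) μ)
    (h0 : ∀ k, ∫ x in integers K, S.χ (S.u k * x) * h x ∂μ = 0) :
    ∀ᵐ x ∂μ.restrict (integers K), h x = 0 := by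
  have hO := measurableSet_integers (K := K)
  have hfin : IsFiniteMeasure (μ.comap ((↑) : integers K → K)) := by
    refine ⟨?_⟩
    rw [(MeasurableEmbedding.subtype_coe hO).comap_apply]
    simpa using isCompact_integers.measure_lt_top
  rw [ae_restrict_iff_subtype hO]
  refine ae_eq_zero_of_integral_charMap_mul S (h := fun x => h x) ?_ fun k => ?_
  · exact (MeasurableEmbedding.subtype_coe hO).integrable_map_iff.mp
      (by rwa [map_comap_subtype_coe hO])
  · rw [← h0 k, ← integral_subtype_comap hO]
    rfl

end Characters

/-! ### Tiling of `K` by cosets of `𝒪`, periodization, scaling of Haar measure -/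

section Cosets

variable {K : Type*} [NontriviallyNormedField K] (S : Setting K)

/-- The coset `u(n) + 𝒪`. -/
def Setting.coset (n : ℕ) : Set K := {x | ‖x - S.u n‖ ≤ 1}

lemma Setting.coset_eq (n : ℕ) : S.coset n = Metric.closedBall (S.u n) 1 := by
  ext x
  rw [Metric.mem_closedBall, dist_eq_norm]
  rfl

lemma Setting.mem_coset {n : ℕ} {x : K} : x ∈ S.coset n ↔ ‖x - S.u n‖ ≤ 1 := Iff.rfl

lemma Setting.add_u_mem_coset {n : ℕ} {x : K} (hx : x ∈ integers K) : x + S.u n ∈ S.coset n := by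
  simpa [Setting.mem_coset, integers] using hx

lemma Setting.iUnion_coset : ⋃ n, S.coset n = Set.univ :=
  Set.eq_univ_of_forall fun x => Set.mem_iUnion.mpr (S.exists_norm_sub_u_le x)

/-- The sum of the translates of a function by the `u(n)`. -/
noncomputable def per (H : K → ℂ) (ξ : K) : ℂ := ∑' n, H (ξ + S.u n)

section Ultrametric

variable [IsUltrametricDist K]

lemma Setting.eq_of_mem_coset {n m : ℕ} {x : K} (hn : x ∈ S.coset n) (hm : x ∈ S.coset m) :
    n = m := by
  refine S.eq_of_norm_u_sub_le n m ?_
  have := Setting.norm_sub_le_one (S.mem_coset.mp hm) (S.mem_coset.mp hn)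
  simpa using this

lemma Setting.add_u_mem_coset_iff {n m : ℕ} {x : K} (hx : x ∈ integers K) :
    x + S.u n ∈ S.coset m ↔ n = m := by
  refine ⟨fun h => S.eq_of_mem_coset (S.add_u_mem_coset hx) h, ?_⟩
  rintro rfl
  exact S.add_u_mem_coset hx

lemma Setting.pairwise_disjoint_coset : Pairwise (Function.onFun Disjoint S.coset) := by
  intro n m hnm
  rw [Function.onFun, Set.disjoint_left]
  exact fun x hn hm => hnm (S.eq_of_mem_coset hn hm)

lemma Setting.setOf_norm_π_mul_le :
    {x : K | ‖S.π * x‖ ≤ 1} = ⋃ d ∈ Finset.range S.q, S.coset d := by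
  ext x
  simp only [Set.mem_ofPred_eq, Finset.mem_range, Set.mem_iUnion, exists_prop]
  constructor
  · intro hx
    obtain ⟨n, hn, hn'⟩ := S.exists_norm_sub_u_le_of_pow 1 (x := x) (by simpa using hx)
    exact ⟨n, by simpa using hn, hn'⟩
  · rintro ⟨d, hd, hd'⟩
    have h1 : ‖S.π * (x - S.u d)‖ ≤ 1 := by
      rw [norm_mul]
      exact mul_le_one₀ S.norm_π_lt.le (norm_nonneg _) hd'
    have := Setting.norm_add_le_one h1 (S.norm_π_mul_u_le hd)
    rwa [← mul_add, sub_add_cancel] at this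

end Ultrametric

variable [ProperSpace K] [MeasurableSpace K] [BorelSpace K]

lemma Setting.measurableSet_coset (n : ℕ) : MeasurableSet (S.coset n) := by
  rw [Setting.coset_eq]; exact measurableSet_closedBall

variable (μ : Measure K) [μ.IsAddHaarMeasure]

lemma measurePreserving_add_u (n : ℕ) : MeasurePreserving (fun x => x + S.u n)
    (μ.restrict (integers K)) (μ.restrict (S.coset n)) := by
  have h := (measurePreserving_add_right μ (S.u n)).restrict_preimage (S.measurableSet_coset n)
  have h2 : (fun x => x + S.u n) ⁻¹' S.coset n = integers K := by
    ext x; simp [Setting.mem_coset, integers]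
  rwa [h2] at h

lemma measurableEmbedding_add_u (n : ℕ) : MeasurableEmbedding (fun x : K => x + S.u n) :=
  (Homeomorph.addRight (S.u n)).measurableEmbedding

lemma setLIntegral_coset (n : ℕ) (f : K → ℝ≥0∞) :
    ∫⁻ x in S.coset n, f x ∂μ = ∫⁻ ξ in integers K, f (ξ + S.u n) ∂μ :=
  ((measurePreserving_add_u S μ n).lintegral_comp_emb (measurableEmbedding_add_u S n) f).symm

lemma setIntegral_coset {E : Type*} [NormedAddCommGroup E] [NormedSpace ℝ E] (n : ℕ) (f : K → E) :
    ∫ x in S.coset n, f x ∂μ = ∫ ξ in integers K, f (ξ + S.u n) ∂μ :=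
  ((measurePreserving_add_u S μ n).integral_comp (measurableEmbedding_add_u S n) f).symm

lemma integrableOn_coset {E : Type*} [NormedAddCommGroup E] (n : ℕ) (f : K → E) :
    IntegrableOn f (S.coset n) μ ↔ IntegrableOn (fun ξ => f (ξ + S.u n)) (integers K) μ :=
  ((measurePreserving_add_u S μ n).integrable_comp_emb (measurableEmbedding_add_u S n)).symm

lemma measure_coset (hμ : μ (integers K) = 1) (n : ℕ) : μ (S.coset n) = 1 := by
  have := setLIntegral_coset S μ n 1
  simpa [hμ] using this

/-- A property holds almost everywhere on `K` iff it holds almost everywhere on `𝒪` along the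
whole fiber. -/
lemma ae_iff_ae_fiber {P : K → Prop} :
    (∀ᵐ x ∂μ, P x) ↔ ∀ᵐ ξ ∂μ.restrict (integers K), ∀ n, P (ξ + S.u n) := by
  rw [ae_all_iff, ← Measure.restrict_univ (μ := μ), ← S.iUnion_coset, ae_restrict_iUnion_iff,
    S.iUnion_coset, Measure.restrict_univ]
  refine forall_congr' fun n => ?_
  rw [← (measurePreserving_add_u S μ n).map_eq, (measurableEmbedding_add_u S n).ae_map_iff]

variable [IsUltrametricDist K]

lemma lintegral_eq_tsum (f : K → ℝ≥0∞) :
    ∫⁻ x, f x ∂μ = ∑' n, ∫⁻ ξ in integers K, f (ξ + S.u n) ∂μ := by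
  rw [← setLIntegral_univ, ← S.iUnion_coset,
    lintegral_iUnion S.measurableSet_coset S.pairwise_disjoint_coset]
  simp only [setLIntegral_coset]

lemma aemeasurable_comp_add_u {β : Type*} [MeasurableSpace β] {f : K → β} (hf : AEMeasurable f μ)
    (n : ℕ) : AEMeasurable (fun ξ => f (ξ + S.u n)) (μ.restrict (integers K)) :=
  (hf.restrict (s := S.coset n)).comp_quasiMeasurePreserving
    (measurePreserving_add_u S μ n).quasiMeasurePreserving

lemma aestronglyMeasurable_comp_add_u {β : Type*} [TopologicalSpace β] {f : K → β}
    (hf : AEStronglyMeasurable f μ) (n : ℕ) :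
    AEStronglyMeasurable (fun ξ => f (ξ + S.u n)) (μ.restrict (integers K)) :=
  (hf.restrict (s := S.coset n)).comp_measurePreserving (measurePreserving_add_u S μ n)

lemma lintegral_eq_lintegral_tsum {f : K → ℝ≥0∞} (hf : AEMeasurable f μ) :
    ∫⁻ x, f x ∂μ = ∫⁻ ξ in integers K, ∑' n, f (ξ + S.u n) ∂μ := by
  rw [lintegral_eq_tsum S μ, lintegral_tsum (fun n => aemeasurable_comp_add_u S μ hf n)]

lemma ae_summable_norm_fiber {H : K → ℂ} (hH : Integrable H μ) :
    ∀ᵐ ξ ∂μ.restrict (integers K), Summable fun n => ‖H (ξ + S.u n)‖ := by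
  have h1 := hH.2
  rw [HasFiniteIntegral, lintegral_eq_lintegral_tsum S μ hH.1.enorm] at h1
  have hm : AEMeasurable (fun ξ => ∑' n, ‖H (ξ + S.u n)‖ₑ) (μ.restrict (integers K)) :=
    AEMeasurable.tsum fun n => aemeasurable_comp_add_u S μ hH.1.enorm n
  filter_upwards [ae_lt_top' hm h1.ne] with ξ hξ
  have := ENNReal.tsum_coe_ne_top_iff_summable.mp hξ.ne
  exact NNReal.summable_coe.mpr this

lemma ae_summable_fiber {H : K → ℂ} (hH : Integrable H μ) :
    ∀ᵐ ξ ∂μ.restrict (integers K), Summable fun n => H (ξ + S.u n) := by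
  filter_upwards [ae_summable_norm_fiber S μ hH] with ξ hξ using hξ.of_norm

lemma integrableOn_per {H : K → ℂ} (hH : Integrable H μ) :
    IntegrableOn (per S H) (integers K) μ := by
  refine ⟨?_, ?_⟩
  · refine aestronglyMeasurable_of_tendsto_ae (u := atTop)
      (f := fun N : ℕ => fun ξ => ∑ n ∈ Finset.range N, H (ξ + S.u n)) (fun N => ?_) ?_
    · exact Finset.aestronglyMeasurable_fun_sum _
        fun n _ => aestronglyMeasurable_comp_add_u S μ hH.1 n
    · filter_upwards [ae_summable_fiber S μ hH] with ξ hξ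
      exact hξ.hasSum.tendsto_sum_nat
  · have h1 := hH.2
    rw [HasFiniteIntegral, lintegral_eq_lintegral_tsum S μ hH.1.enorm] at h1
    refine lt_of_le_of_lt (lintegral_mono_ae ?_) h1
    filter_upwards [ae_summable_norm_fiber S μ hH] with ξ hξ
    exact enorm_tsum_le_tsum_enorm

lemma setIntegral_per {H : K → ℂ} (hH : Integrable H μ) :
    ∫ ξ in integers K, per S H ξ ∂μ = ∫ x, H x ∂μ := by
  have h1 := hH.2
  rw [HasFiniteIntegral, lintegral_eq_tsum S μ] at h1
  have h2 := integral_tsum (fun n => aestronglyMeasurable_comp_add_u S μ hH.1 n) h1.ne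
  have h3 := hasSum_integral_iUnion S.measurableSet_coset S.pairwise_disjoint_coset
    (f := H) (μ := μ) hH.integrableOn
  rw [S.iUnion_coset, Measure.restrict_univ] at h3
  simp only [setIntegral_coset] at h3
  exact h2.trans h3.tsum_eq

/-- Multiplication by the prime element multiplies volumes by `q⁻¹`. -/
lemma map_π_mul (hμ : μ (integers K) = 1) :
    μ.map (fun x => S.π * x) = (S.q : ℝ≥0∞) • μ := by
  obtain ⟨C, -, hC⟩ := exists_map_mul μ S.π S.π_ne_zero
  have h1 := congr_arg (fun ν => ν (integers K)) hC
  -- The scalar `C` is the measure of `π⁻¹𝒪`, a disjoint union of `q` cosets of measure `1`.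
  simp only [Measure.smul_apply, hμ, smul_eq_mul, mul_one] at h1
  rw [Measure.map_apply (by fun_prop) measurableSet_integers] at h1
  have h2 : (fun x => S.π * x) ⁻¹' integers K = ⋃ d ∈ Finset.range S.q, S.coset d :=
    S.setOf_norm_π_mul_le
  rw [h2, measure_biUnion_finset (S.pairwise_disjoint_coset.set_pairwise _)
    fun d _ => S.measurableSet_coset d] at h1
  simp only [measure_coset S μ hμ, Finset.sum_const, Finset.card_range, nsmul_eq_mul,
    mul_one] at h1
  rw [hC, ← h1]

lemma measurableEmbedding_mul {a : K} (ha : a ≠ 0) : MeasurableEmbedding (fun x : K => a * x) :=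
  (Homeomorph.mulLeft₀ a ha).measurableEmbedding

lemma integral_π_mul (hμ : μ (integers K) = 1) (f : K → ℂ) :
    ∫ x, f (S.π * x) ∂μ = S.q * ∫ x, f x ∂μ := by
  have h := (measurableEmbedding_mul S.π_ne_zero).integral_map (μ := μ) f
  rw [map_π_mul S μ hμ, integral_smul_measure] at h
  rw [← h]
  simp

lemma lintegral_π_mul (hμ : μ (integers K) = 1) (f : K → ℝ≥0∞) :
    ∫⁻ x, f (S.π * x) ∂μ = S.q * ∫⁻ x, f x ∂μ := by
  have h := (measurableEmbedding_mul S.π_ne_zero).lintegral_map (μ := μ) f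
  rw [map_π_mul S μ hμ, lintegral_smul_measure] at h
  rw [← h, smul_eq_mul]

end Cosets

/-! ### The Fourier transform as a unitary operator -/

section Plancherel

variable {K : Type*} [NontriviallyNormedField K] [IsUltrametricDist K] [ProperSpace K]
  [MeasurableSpace K] [BorelSpace K] (S : Setting K) (μ : Measure K) [μ.IsAddHaarMeasure]

lemma Setting.continuous_χ_mul (a : K) : Continuous fun x => (S.χ (a * x) : ℂ) :=
  continuous_induced_dom.comp (S.continuous_χ.comp (by fun_prop))

lemma Setting.norm_χ (x : K) : ‖(S.χ x : ℂ)‖ = 1 := Circle.norm_coe _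

lemma Setting.conj_χ (x : K) : (starRingEnd ℂ) (S.χ x : ℂ) = S.χ (-x) := by
  rw [AddChar.map_neg_eq_inv, Circle.coe_inv_eq_conj]

lemma Setting.χ_add (x y : K) : (S.χ (x + y) : ℂ) = S.χ x * S.χ y := by
  rw [AddChar.map_add_eq_mul, Circle.coe_mul]

lemma Setting.χ_zero : (S.χ 0 : ℂ) = 1 := by rw [AddChar.map_zero_eq_one, Circle.coe_one]

lemma Setting.χ_u_mul_u' (k l : ℕ) : (S.χ (S.u k * S.u l) : ℂ) = 1 := by
  rw [S.χ_u_mul_u, Circle.coe_one]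

/-- Translating by some `y ∈ 𝒪` with `χ(a y) ≠ 1` preserves the integral and also multiplies it by
`χ(a y)`. -/
lemma setIntegral_χ_of_one_lt {a : K} (ha : 1 < ‖a‖) :
    ∫ x in integers K, (S.χ (a * x) : ℂ) ∂μ = 0 := by
  obtain ⟨y, hy, hy'⟩ := S.exists_χ_mul_ne_one ha
  have hpre : (fun x => x + y) ⁻¹' integers K = integers K := by
    ext x
    refine ⟨fun h => ?_, fun h => Setting.norm_add_le_one h hy⟩
    have := Setting.norm_sub_le_one (x := x + y) h hy
    rwa [add_sub_cancel_right] at this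
  have h1 := (measurePreserving_add_right μ y).setIntegral_preimage_emb
    (Homeomorph.addRight y).measurableEmbedding (fun x => (S.χ (a * x) : ℂ)) (integers K)
  rw [hpre] at h1
  simp only [mul_add, S.χ_add] at h1
  rw [integral_mul_const] at h1
  have h2 : (∫ x in integers K, (S.χ (a * x) : ℂ) ∂μ) * ((S.χ (a * y) : ℂ) - 1) = 0 := by
    rw [mul_sub, h1]; ring
  refine (mul_eq_zero.mp h2).resolve_right fun h3 => hy' (Circle.ext ?_)
  rw [Circle.coe_one]
  exact sub_eq_zero.mp h3

lemma setIntegral_χ_of_le_one (hμ : μ (integers K) = 1) {a : K} (ha : ‖a‖ ≤ 1) :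
    ∫ x in integers K, (S.χ (a * x) : ℂ) ∂μ = 1 := by
  have : ∀ x ∈ integers K, (S.χ (a * x) : ℂ) = 1 := fun x hx => by
    rw [S.χ_integers _ (by rw [norm_mul]; exact mul_le_one₀ ha (norm_nonneg _) hx), Circle.coe_one]
  rw [setIntegral_congr_fun measurableSet_integers this]
  simp [Measure.real, hμ]

lemma setIntegral_coset_χ (n : ℕ) (a : K) :
    ∫ x in S.coset n, (S.χ (a * x) : ℂ) ∂μ =
      S.χ (a * S.u n) * ∫ x in integers K, (S.χ (a * x) : ℂ) ∂μ := by
  rw [setIntegral_coset]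
  simp only [mul_add, S.χ_add]
  rw [integral_mul_const, mul_comm]

lemma measure_coset_lt_top (n : ℕ) : μ (S.coset n) < ∞ := by
  rw [S.coset_eq]; exact measure_closedBall_lt_top

/-- The character `x ↦ χ(a x)` cut off to the coset `u(n) + 𝒪`. -/
noncomputable def wave (a : K) (n : ℕ) : K → ℂ :=
  (S.coset n).indicator fun x => (S.χ (a * x) : ℂ)

instance isFiniteMeasure_restrict_coset (n : ℕ) : IsFiniteMeasure (μ.restrict (S.coset n)) :=
  ⟨by simpa using measure_coset_lt_top S μ n⟩

lemma memLp_wave (a : K) (n : ℕ) (p : ℝ≥0∞) : MemLp (wave S a n) p μ :=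
  (memLp_indicator_iff_restrict (S.measurableSet_coset n)).mpr <|
    MemLp.of_bound (S.continuous_χ_mul a).aestronglyMeasurable 1
      (Eventually.of_forall fun _ => (S.norm_χ _).le)

/-- The function `wave S a n` as a member of `L²(K)`. -/
noncomputable def waveLp (a : K) (n : ℕ) : Lp ℂ 2 μ := (memLp_wave S μ a n 2).toLp

lemma coeFn_waveLp (a : K) (n : ℕ) : waveLp S μ a n =ᵐ[μ] wave S a n := MemLp.coeFn_toLp _

lemma inner_waveLp (a : K) (n : ℕ) (f : Lp ℂ 2 μ) :
    inner ℂ (waveLp S μ a n) f = ∫ x in S.coset n, (S.χ (-a * x) : ℂ) * f x ∂μ := by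
  rw [L2.inner_def, ← integral_indicator (S.measurableSet_coset n)]
  refine integral_congr_ae ?_
  filter_upwards [coeFn_waveLp S μ a n] with x hx
  rw [hx, wave, RCLike.inner_apply']
  by_cases h : x ∈ S.coset n
  · simp [h, S.conj_χ]
  · simp [h]

lemma integrableOn_L2_coset (f : Lp ℂ 2 μ) (n : ℕ) : IntegrableOn f (S.coset n) μ :=
  ((Lp.memLp f).restrict (S.coset n)).integrable (by norm_num)

/-- A function in `L²(K)` is determined by its integrals against characters over cosets. -/
lemma ae_eq_zero_of_setIntegral_coset {h : K → ℂ} (hi : ∀ n, IntegrableOn h (S.coset n) μ)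
    (h0 : ∀ k n, ∫ x in S.coset n, (S.χ (S.u k * x) : ℂ) * h x ∂μ = 0) : h =ᵐ[μ] 0 := by
  rw [EventuallyEq, ae_iff_ae_fiber S μ, ae_all_iff]
  intro n
  refine ae_eq_zero_of_setIntegral_χ_mul S μ (h := fun ξ => h (ξ + S.u n))
    ((integrableOn_coset S μ n h).mp (hi n)) fun k => ?_
  have := h0 k n
  rw [setIntegral_coset] at this
  simpa only [S.χ_u_mul_add] using this

/-- Distinct cosets give disjoint supports; on one coset, distinct frequencies differ by more than
`1` in norm and the character integral vanishes. The frequencies `v` are left general to cover both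
`u(m)` and `-u(m)`. -/
lemma orthonormal_waveLp (hμ : μ (integers K) = 1) {v : ℕ → K}
    (hv : ∀ m m', m ≠ m' → 1 < ‖v m - v m'‖) :
    Orthonormal ℂ fun i : ℕ × ℕ => waveLp S μ (v i.1) i.2 := by
  classical
  rw [orthonormal_iff_ite]
  rintro ⟨m, n⟩ ⟨m', n'⟩
  dsimp only
  have h1 : inner ℂ (waveLp S μ (v m) n) (waveLp S μ (v m') n') =
      ∫ x in S.coset n, (S.χ (-v m * x) : ℂ) * wave S (v m') n' x ∂μ := by
    rw [inner_waveLp]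
    refine integral_congr_ae (ae_restrict_of_ae ?_)
    filter_upwards [coeFn_waveLp S μ (v m') n'] with x hx
    rw [hx]
  rw [h1]
  by_cases hn : n = n'
  · subst hn
    have h2 : ∫ x in S.coset n, (S.χ (-v m * x) : ℂ) * wave S (v m') n x ∂μ =
        ∫ x in S.coset n, (S.χ ((v m' - v m) * x) : ℂ) ∂μ := by
      refine setIntegral_congr_fun (S.measurableSet_coset n) fun x hx => ?_
      simp only [wave, Set.indicator_of_mem hx, ← S.χ_add]
      ring_nf
    rw [h2, setIntegral_coset_χ]
    by_cases hm : m = m'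
    · subst hm
      rw [setIntegral_χ_of_le_one S μ hμ (by simp)]
      simp
    · rw [setIntegral_χ_of_one_lt S μ (hv _ _ (Ne.symm hm))]
      simp [hm]
  · rw [if_neg (by simp [hn])]
    refine setIntegral_eq_zero_of_forall_eq_zero fun x hx => ?_
    have : x ∉ S.coset n' := fun h => hn (S.eq_of_mem_coset hx h)
    simp [wave, this]

lemma span_waveLp_orthogonal {v : ℕ → K} (hv : ∀ k, ∃ m, -v m = S.u k) :
    (Submodule.span ℂ (Set.range fun i : ℕ × ℕ => waveLp S μ (v i.1) i.2))ᗮ = ⊥ := by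
  rw [eq_bot_iff]
  intro f hf
  rw [Submodule.mem_bot, Lp.eq_zero_iff_ae_eq_zero]
  refine ae_eq_zero_of_setIntegral_coset S μ (integrableOn_L2_coset S μ f) fun k n => ?_
  obtain ⟨m, hm⟩ := hv k
  rw [← hm, ← inner_waveLp]
  exact Submodule.inner_right_of_mem_orthogonal
    (Submodule.subset_span (Set.mem_range_self (m, n))) hf

/-- The orthonormal basis of `L²(K)` formed by the functions `χ(u(m) x) 1_{u(n) + 𝒪}(x)`. -/
noncomputable def timeBasis (hμ : μ (integers K) = 1) : HilbertBasis (ℕ × ℕ) ℂ (Lp ℂ 2 μ) :=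
  HilbertBasis.mkOfOrthogonalEqBot
    (orthonormal_waveLp S μ hμ (v := S.u) (fun _ _ h => S.one_lt_norm_u_sub h))
    (span_waveLp_orthogonal S μ fun k => by
      obtain ⟨m, hm⟩ := S.exists_u_neg k
      exact ⟨m, by rw [← hm, neg_neg]⟩)

lemma timeBasis_apply (hμ : μ (integers K) = 1) (i : ℕ × ℕ) :
    timeBasis S μ hμ i = waveLp S μ (S.u i.1) i.2 := by
  simp [timeBasis]

/-- The orthonormal basis of `L²(K)` formed by the Fourier transforms
`χ(-u(n) ξ) 1_{u(m) + 𝒪}(ξ)` of the members of `timeBasis`. -/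
noncomputable def freqBasis (hμ : μ (integers K) = 1) : HilbertBasis (ℕ × ℕ) ℂ (Lp ℂ 2 μ) :=
  HilbertBasis.mkOfOrthogonalEqBot
    (v := (fun i : ℕ × ℕ => waveLp S μ (-S.u i.1) i.2) ∘ Prod.swap)
    ((orthonormal_waveLp S μ hμ (v := fun n => -S.u n)
      (fun m m' h => by
        rw [← neg_sub_neg, neg_neg, neg_neg]
        exact S.one_lt_norm_u_sub h.symm)).comp _ Prod.swap_injective)
    (by
      rw [Prod.swap_surjective.range_comp]
      have h : ∀ k, ∃ m, - -S.u m = S.u k := fun k => ⟨k, neg_neg _⟩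
      exact span_waveLp_orthogonal S μ (v := fun n => -S.u n) h)

lemma freqBasis_apply (hμ : μ (integers K) = 1) (i : ℕ × ℕ) :
    freqBasis S μ hμ i = waveLp S μ (-S.u i.2) i.1 := by
  simp [freqBasis]

/-- The unitary operator that maps `timeBasis` to `freqBasis`. -/
noncomputable def plancherel (hμ : μ (integers K) = 1) : Lp ℂ 2 μ ≃ₗᵢ[ℂ] Lp ℂ 2 μ :=
  (timeBasis S μ hμ).repr.trans (freqBasis S μ hμ).repr.symm

lemma inner_freqBasis_plancherel (hμ : μ (integers K) = 1) (f : Lp ℂ 2 μ) (i : ℕ × ℕ) :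
    inner ℂ (freqBasis S μ hμ i) (plancherel S μ hμ f) = inner ℂ (timeBasis S μ hμ i) f := by
  rw [← HilbertBasis.repr_apply_apply, ← HilbertBasis.repr_apply_apply]
  simp [plancherel]

lemma continuous_χ_neg_mul : Continuous fun z : K × K => (S.χ (-(z.1 * z.2)) : ℂ) :=
  continuous_induced_dom.comp (S.continuous_χ.comp (by fun_prop))

lemma norm_fourierIntegral_le (G : K → ℂ) (ξ : K) :
    ‖fourierIntegral S μ G ξ‖ ≤ ∫ x, ‖G x‖ ∂μ := by
  refine (norm_integral_le_integral_norm _).trans (le_of_eq ?_)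
  simp [S.norm_χ]

lemma aestronglyMeasurable_fourierIntegral {G : K → ℂ} (hG : Integrable G μ) :
    AEStronglyMeasurable (fourierIntegral S μ G) μ := by
  have h : AEStronglyMeasurable (fun z : K × K => G z.2 * (S.χ (-(z.1 * z.2)) : ℂ)) (μ.prod μ) :=
    hG.1.comp_snd.mul (continuous_χ_neg_mul S).aestronglyMeasurable
  exact h.integral_prod_right'

/-- Fubini: the inner integral of `χ((u(n) - x) ξ)` over `u(m) + 𝒪` vanishes unless `x ∈ u(n) + 𝒪`,
and there it is `χ(-u(m) x)`, since `χ(u(n) u(m)) = 1`. So the coefficients of the Fourier integral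
against `freqBasis` are those of `G` against `timeBasis`. -/
lemma setIntegral_coset_χ_mul_fourierIntegral (hμ : μ (integers K) = 1) {G : K → ℂ}
    (hG : Integrable G μ) (m n : ℕ) :
    ∫ ξ in S.coset m, (S.χ (S.u n * ξ) : ℂ) * fourierIntegral S μ G ξ ∂μ =
      ∫ x in S.coset n, (S.χ (-S.u m * x) : ℂ) * G x ∂μ := by
  have h1 : Integrable (fun z : K × K => (S.χ (S.u n * z.1) : ℂ) *
      (G z.2 * (S.χ (-(z.1 * z.2)) : ℂ))) ((μ.restrict (S.coset m)).prod μ) := by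
    refine Integrable.bdd_mul (c := 1) (Integrable.mul_bdd (c := 1)
      (hG.comp_snd (μ.restrict (S.coset m)))
      (continuous_χ_neg_mul S).aestronglyMeasurable ?_) ?_ ?_
    · exact Eventually.of_forall fun z => (S.norm_χ _).le
    · exact ((S.continuous_χ_mul (S.u n)).comp continuous_fst).aestronglyMeasurable
    · exact Eventually.of_forall fun z => (S.norm_χ _).le
  calc ∫ ξ in S.coset m, (S.χ (S.u n * ξ) : ℂ) * fourierIntegral S μ G ξ ∂μ
      = ∫ ξ in S.coset m, ∫ x, (S.χ (S.u n * ξ) : ℂ) * (G x * (S.χ (-(ξ * x)) : ℂ)) ∂μ ∂μ := by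
        refine integral_congr_ae (Eventually.of_forall fun ξ => ?_)
        exact (integral_const_mul _ _).symm
    _ = ∫ x, ∫ ξ in S.coset m, (S.χ (S.u n * ξ) : ℂ) * (G x * (S.χ (-(ξ * x)) : ℂ)) ∂μ ∂μ :=
        integral_integral_swap h1
    _ = ∫ x, (S.coset n).indicator (fun x => (S.χ (-S.u m * x) : ℂ) * G x) x ∂μ := by
        refine integral_congr_ae (Eventually.of_forall fun x => ?_)
        have h2 : ∀ ξ, (S.χ (S.u n * ξ) : ℂ) * (G x * (S.χ (-(ξ * x)) : ℂ)) =
            G x * (S.χ ((S.u n - x) * ξ) : ℂ) := fun ξ => by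
          rw [show (S.u n - x) * ξ = S.u n * ξ + -(ξ * x) by ring, S.χ_add]
          ring
        simp only [h2]
        rw [integral_const_mul, setIntegral_coset_χ]
        by_cases hx : x ∈ S.coset n
        · rw [setIntegral_χ_of_le_one S μ hμ (by rw [norm_sub_rev]; exact hx),
            Set.indicator_of_mem hx,
            show (S.u n - x) * S.u m = S.u n * S.u m + -S.u m * x by ring, S.χ_add,
            S.χ_u_mul_u']
          ring
        · rw [setIntegral_χ_of_one_lt S μ (by
            rw [norm_sub_rev]; exact not_le.mp hx), Set.indicator_of_notMem hx]
          ring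
    _ = _ := integral_indicator (S.measurableSet_coset n)

/-- On `L¹ ∩ L²`, the operator `plancherel` is given by the Fourier integral. -/
lemma fourierIntegral_ae_eq_plancherel (hμ : μ (integers K) = 1) {G : K → ℂ}
    (hG : Integrable G μ) (hG2 : MemLp G 2 μ) :
    fourierIntegral S μ G =ᵐ[μ] plancherel S μ hμ hG2.toLp := by
  have hFi : ∀ n, IntegrableOn (fourierIntegral S μ G) (S.coset n) μ := fun n =>
    Measure.integrableOn_of_bounded (measure_coset_lt_top S μ n).ne
      (aestronglyMeasurable_fourierIntegral S μ hG)
      (Eventually.of_forall (norm_fourierIntegral_le S μ G))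
  have hΦi := integrableOn_L2_coset S μ (plancherel S μ hμ hG2.toLp)
  have hmul : ∀ {h : K → ℂ} (n k : ℕ), IntegrableOn h (S.coset n) μ →
      IntegrableOn (fun x => (S.χ (S.u k * x) : ℂ) * h x) (S.coset n) μ := fun n k hh =>
    hh.bdd_mul (c := 1) (S.continuous_χ_mul _).aestronglyMeasurable
      (Eventually.of_forall fun z => (S.norm_χ _).le)
  -- Both sides have the same coefficients against `freqBasis`. The left side is not yet known to be
  -- in `L²`, so the comparison is made through integrals over cosets.
  have h0 : (fun ξ => fourierIntegral S μ G ξ - plancherel S μ hμ hG2.toLp ξ) =ᵐ[μ] 0 := by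
    refine ae_eq_zero_of_setIntegral_coset S μ (fun n => (hFi n).sub (hΦi n)) fun k n => ?_
    simp only [mul_sub]
    rw [integral_sub (hmul n k (hFi n)) (hmul n k (hΦi n)), sub_eq_zero,
      setIntegral_coset_χ_mul_fourierIntegral S μ hμ hG]
    have h2 := inner_freqBasis_plancherel S μ hμ hG2.toLp (n, k)
    rw [freqBasis_apply, timeBasis_apply, inner_waveLp, inner_waveLp, neg_neg] at h2
    rw [h2]
    refine integral_congr_ae (ae_restrict_of_ae ?_)
    filter_upwards [hG2.coeFn_toLp] with x hx
    rw [hx]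
  filter_upwards [h0] with ξ hξ
  exact sub_eq_zero.mp hξ

/-- The restriction of `f` to the ball `π⁻ᴺ 𝒪`. -/
noncomputable def trunc (N : ℕ) (f : K → ℂ) : K → ℂ := {x : K | ‖S.π ^ N * x‖ ≤ 1}.indicator f

lemma isClosed_ball (N : ℕ) : IsClosed {x : K | ‖S.π ^ N * x‖ ≤ 1} :=
  isClosed_le (by fun_prop) continuous_const

lemma measure_ball_lt_top (N : ℕ) : μ {x : K | ‖S.π ^ N * x‖ ≤ 1} < ∞ := by
  refine lt_of_le_of_lt (measure_mono fun x hx => ?_)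
    (measure_closedBall_lt_top (x := (0 : K)) (r := (‖S.π‖ ^ N)⁻¹))
  rw [mem_closedBall_zero_iff]
  rw [Set.mem_ofPred_eq, norm_mul, norm_pow] at hx
  exact (le_inv_mul_iff₀ (pow_pos S.norm_π_pos N)).mpr hx |>.trans_eq (mul_one _)

lemma memLp_trunc (N : ℕ) (f : Lp ℂ 2 μ) : MemLp (trunc S N f) 2 μ :=
  (Lp.memLp f).indicator (isClosed_ball S N).measurableSet

lemma integrable_trunc (N : ℕ) (f : Lp ℂ 2 μ) : Integrable (trunc S N f) μ := by
  rw [trunc, integrable_indicator_iff (isClosed_ball S N).measurableSet]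
  have : IsFiniteMeasure (μ.restrict {x : K | ‖S.π ^ N * x‖ ≤ 1}) :=
    ⟨by simpa using measure_ball_lt_top S μ N⟩
  exact ((Lp.memLp f).restrict _).integrable (by norm_num)

lemma tendsto_trunc (f : Lp ℂ 2 μ) :
    Tendsto (fun N => (memLp_trunc S μ N f).toLp) atTop (𝓝 f) := by
  have h := Lp.tendsto_Lp_iff_tendsto_eLpNorm'' (fi := atTop) (fun N => trunc S N f)
    (fun N => memLp_trunc S μ N f) f (Lp.memLp f)
  rw [Lp.toLp_coeFn] at h
  rw [h]
  have h2 : ∀ N, eLpNorm (trunc S N f - (f : K → ℂ)) 2 μ =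
      (∫⁻ x, ‖(trunc S N f - (f : K → ℂ)) x‖ₑ ^ (2 : ℝ) ∂μ) ^ (1 / (2 : ℝ)) := fun N => by
    rw [eLpNorm_eq_lintegral_rpow_enorm_toReal (by norm_num) (by norm_num)]
    simp
  have h3 : Tendsto (fun N => ∫⁻ x, ‖(trunc S N f - (f : K → ℂ)) x‖ₑ ^ (2 : ℝ) ∂μ) atTop
      (𝓝 (∫⁻ _, 0 ∂μ)) := by
    refine tendsto_lintegral_of_dominated_convergence' (fun x => ‖f x‖ₑ ^ (2 : ℝ))
      (fun N => ?_) (fun N => ?_) ?_ ?_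
    · exact ((memLp_trunc S μ N f).sub (Lp.memLp f)).1.enorm.pow_const _
    · refine Eventually.of_forall fun x => ?_
      simp only
      gcongr
      simp only [Pi.sub_apply, trunc]
      by_cases hx : x ∈ {x : K | ‖S.π ^ N * x‖ ≤ 1}
      · rw [Set.indicator_of_mem hx]; simp
      · rw [Set.indicator_of_notMem hx]; simp
    · have := (Lp.memLp f).2
      rw [eLpNorm_lt_top_iff_lintegral_rpow_enorm_lt_top (by norm_num) (by norm_num)] at this
      simpa using this.ne
    · refine Eventually.of_forall fun x => ?_
      obtain ⟨N, hN⟩ := S.exists_pow_mul_le x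
      refine tendsto_const_nhds.congr' ?_
      filter_upwards [eventually_ge_atTop N] with M hM
      have hx : x ∈ {x : K | ‖S.π ^ M * x‖ ≤ 1} := hN M hM
      rw [Pi.sub_apply, trunc, Set.indicator_of_mem hx]
      simp
  rw [lintegral_zero] at h3
  simp only [h2]
  simpa using h3.ennrpow_const (1 / 2)

/-- The truncations of `f` tend to `f` in `L²`, so their transforms tend to `plancherel f`. This
gives both the existence and the uniqueness needed to evaluate the choice in `fourier`. -/
lemma isFourierTransform_iff (hμ : μ (integers K) = 1) (f g : Lp ℂ 2 μ) :
    IsFourierTransform S μ f g ↔ g = plancherel S μ hμ f := by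
  have h1 : IsFourierTransform S μ f g ↔
      Tendsto (fun N => plancherel S μ hμ (memLp_trunc S μ N f).toLp) atTop (𝓝 g) := by
    rw [Lp.tendsto_Lp_iff_tendsto_eLpNorm']
    refine tendsto_congr fun N => eLpNorm_congr_ae ?_
    filter_upwards [fourierIntegral_ae_eq_plancherel S μ hμ (integrable_trunc S μ N f)
      (memLp_trunc S μ N f)] with ξ hξ
    rw [Pi.sub_apply, ← hξ]
    rfl
  have h2 := ((plancherel S μ hμ).continuous.tendsto f).comp (tendsto_trunc S μ f)
  rw [h1]
  exact ⟨fun h => tendsto_nhds_unique h h2, fun h => h ▸ h2⟩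

/-- **Plancherel**: the Fourier transform is unitary. -/
lemma fourier_eq_plancherel (hμ : μ (integers K) = 1) (f : Lp ℂ 2 μ) :
    fourier S μ f = plancherel S μ hμ f := by
  rw [← isFourierTransform_iff]
  exact Classical.epsilon_spec (p := IsFourierTransform S μ f)
    ⟨_, (isFourierTransform_iff S μ hμ f _).mpr rfl⟩

end Plancherel

/-! ### Translations and dilations on the Fourier side -/

section Intertwining

variable {K : Type*} [NontriviallyNormedField K] [IsUltrametricDist K] [ProperSpace K]
  [MeasurableSpace K] [BorelSpace K] (S : Setting K) (μ : Measure K) [μ.IsAddHaarMeasure]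

lemma L2_norm_eq_of_lintegral {f g : Lp ℂ 2 μ}
    (h : ∫⁻ x, ‖f x‖ₑ ^ (2 : ℝ) ∂μ = ∫⁻ x, ‖g x‖ₑ ^ (2 : ℝ) ∂μ) : ‖f‖ = ‖g‖ := by
  rw [Lp.norm_def, Lp.norm_def, eLpNorm_eq_lintegral_rpow_enorm_toReal (by norm_num) (by norm_num),
    eLpNorm_eq_lintegral_rpow_enorm_toReal (by norm_num) (by norm_num)]
  simp only [ENNReal.toReal_ofNat, h]

lemma memLp_χ_mul (a : K) (f : Lp ℂ 2 μ) : MemLp (fun ξ => (S.χ (-(a * ξ)) : ℂ) * f ξ) 2 μ := by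
  refine (Lp.memLp f).of_le (AEStronglyMeasurable.mul ?_ (Lp.aestronglyMeasurable f)) ?_
  · simp only [← neg_mul]
    exact (S.continuous_χ_mul (-a)).aestronglyMeasurable
  · exact Eventually.of_forall fun ξ => by rw [norm_mul, S.norm_χ, one_mul]

/-- Multiplication by the character `ξ ↦ χ(-a ξ)`, the Fourier transform of the translation
by `a`. -/
noncomputable def modul (a : K) : Lp ℂ 2 μ →ₗᵢ[ℂ] Lp ℂ 2 μ where
  toFun f := (memLp_χ_mul S μ a f).toLp
  map_add' f g := by
    rw [← MemLp.toLp_add]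
    refine MemLp.toLp_congr _ _ ?_
    filter_upwards [Lp.coeFn_add f g] with x hx
    simp only [Pi.add_apply] at hx ⊢
    rw [hx, mul_add]
  map_smul' r f := by
    rw [RingHom.id_apply, ← MemLp.toLp_const_smul]
    refine MemLp.toLp_congr _ _ ?_
    filter_upwards [Lp.coeFn_smul r f] with x hx
    simp only [Pi.smul_apply, smul_eq_mul] at hx ⊢
    rw [hx]
    ring
  norm_map' f := by
    refine L2_norm_eq_of_lintegral μ (lintegral_congr_ae ?_)
    filter_upwards [(memLp_χ_mul S μ a f).coeFn_toLp] with x hx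
    simp only [LinearMap.coe_mk, AddHom.coe_mk]
    rw [hx, enorm_mul, enorm_eq_nnnorm, show ‖(S.χ (-(a * x)) : ℂ)‖₊ = 1 from
      NNReal.eq (S.norm_χ _), ENNReal.coe_one, one_mul]

lemma coeFn_modul (a : K) (f : Lp ℂ 2 μ) :
    modul S μ a f =ᵐ[μ] fun ξ => (S.χ (-(a * ξ)) : ℂ) * f ξ :=
  (memLp_χ_mul S μ a f).coeFn_toLp

lemma sqrt_q_ne_zero : Real.sqrt S.q ≠ 0 :=
  (Real.sqrt_pos.mpr (Nat.cast_pos.mpr S.q_pos)).ne'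

lemma enorm_sqrt_q_rpow : ‖((Real.sqrt S.q : ℝ) : ℂ)‖ₑ ^ (2 : ℝ) = S.q := by
  rw [← ofReal_norm, Complex.norm_real, Real.norm_of_nonneg (Real.sqrt_nonneg _),
    ENNReal.ofReal_rpow_of_nonneg (Real.sqrt_nonneg _) (by norm_num)]
  simp [Real.sq_sqrt]

lemma enorm_inv_sqrt_q_rpow : ‖(((Real.sqrt S.q)⁻¹ : ℝ) : ℂ)‖ₑ ^ (2 : ℝ) = (S.q : ℝ≥0∞)⁻¹ := by
  rw [← enorm_sqrt_q_rpow S, Complex.ofReal_inv, enorm_inv (by simpa using sqrt_q_ne_zero S),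
    ENNReal.inv_rpow]

/-- The dilation `G ↦ q^(-1/2) G(π ·)`, the Fourier transform of the dilation `D`. -/
noncomputable def freqDil (hμ : μ (integers K) = 1) : Lp ℂ 2 μ →ₗᵢ[ℂ] Lp ℂ 2 μ where
  toFun f := (memLp_mul μ S.π S.π_ne_zero (((Real.sqrt S.q)⁻¹ : ℝ) : ℂ) f).toLp
  map_add' f g := by
    rw [← MemLp.toLp_add]
    refine MemLp.toLp_congr _ _ ?_
    filter_upwards [(quasi_mul μ S.π S.π_ne_zero).ae (Lp.coeFn_add f g)] with x hx
    simp only [Pi.add_apply] at hx ⊢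
    rw [hx, mul_add]
  map_smul' r f := by
    rw [RingHom.id_apply, ← MemLp.toLp_const_smul]
    refine MemLp.toLp_congr _ _ ?_
    filter_upwards [(quasi_mul μ S.π S.π_ne_zero).ae (Lp.coeFn_smul r f)] with x hx
    simp only [Pi.smul_apply, smul_eq_mul] at hx ⊢
    rw [hx]
    ring
  norm_map' f := by
    refine L2_norm_eq_of_lintegral μ ?_
    have h1 : ∫⁻ x, ‖(memLp_mul μ S.π S.π_ne_zero (((Real.sqrt S.q)⁻¹ : ℝ) : ℂ) f).toLp _ x‖ₑ
        ^ (2 : ℝ) ∂μ = ∫⁻ x, (S.q : ℝ≥0∞)⁻¹ * ‖f (S.π * x)‖ₑ ^ (2 : ℝ) ∂μ := by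
      refine lintegral_congr_ae ?_
      filter_upwards [(memLp_mul μ S.π S.π_ne_zero (((Real.sqrt S.q)⁻¹ : ℝ) : ℂ) f).coeFn_toLp]
        with x hx
      rw [hx, enorm_mul, ENNReal.mul_rpow_of_nonneg _ _ (by norm_num), enorm_inv_sqrt_q_rpow]
    have hq : (S.q : ℝ≥0∞) ≠ 0 := Nat.cast_ne_zero.mpr S.q_pos.ne'
    refine h1.trans ?_
    rw [lintegral_const_mul' _ _ (ENNReal.inv_ne_top.mpr hq),
      lintegral_π_mul S μ hμ (fun x => ‖f x‖ₑ ^ (2 : ℝ)), ← mul_assoc,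
      ENNReal.inv_mul_cancel hq (ENNReal.natCast_ne_top _), one_mul]

lemma coeFn_freqDil (hμ : μ (integers K) = 1) (f : Lp ℂ 2 μ) :
    freqDil S μ hμ f =ᵐ[μ] fun ξ => (((Real.sqrt S.q)⁻¹ : ℝ) : ℂ) * f (S.π * ξ) :=
  (memLp_mul μ S.π S.π_ne_zero (((Real.sqrt S.q)⁻¹ : ℝ) : ℂ) f).coeFn_toLp

lemma coeFn_D (f : Lp ℂ 2 μ) :
    D S μ f =ᵐ[μ] fun x => (Real.sqrt S.q : ℂ) * f (S.π⁻¹ * x) :=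
  (memLp_mul μ S.π⁻¹ (inv_ne_zero S.π_ne_zero) (Real.sqrt S.q : ℂ) f).coeFn_toLp

lemma coeFn_shift (a : K) (f : Lp ℂ 2 μ) : shift μ a f =ᵐ[μ] fun x => f (x - a) :=
  Lp.coeFn_compMeasurePreserving f (measurePreserving_sub_right μ a)

lemma norm_shift (a : K) (f : Lp ℂ 2 μ) : ‖shift μ a f‖ = ‖f‖ :=
  Lp.norm_compMeasurePreserving f (measurePreserving_sub_right μ a)

lemma norm_D (hμ : μ (integers K) = 1) (f : Lp ℂ 2 μ) : ‖D S μ f‖ = ‖f‖ := by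
  refine L2_norm_eq_of_lintegral μ ?_
  have h1 : ∫⁻ x, ‖D S μ f x‖ₑ ^ (2 : ℝ) ∂μ =
      ∫⁻ x, (S.q : ℝ≥0∞) * ‖f (S.π⁻¹ * x)‖ₑ ^ (2 : ℝ) ∂μ := by
    refine lintegral_congr_ae ?_
    filter_upwards [coeFn_D S μ f] with x hx
    rw [hx, enorm_mul, ENNReal.mul_rpow_of_nonneg _ _ (by norm_num), enorm_sqrt_q_rpow]
  have h2 := lintegral_π_mul S μ hμ (fun x => ‖f (S.π⁻¹ * x)‖ₑ ^ (2 : ℝ))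
  simp only [inv_mul_cancel_left₀ S.π_ne_zero] at h2
  rw [h1, h2, lintegral_const_mul' _ _ (ENNReal.natCast_ne_top _)]

lemma fourierIntegral_congr {G H : K → ℂ} (h : G =ᵐ[μ] H) :
    fourierIntegral S μ G = fourierIntegral S μ H := by
  ext ξ
  refine integral_congr_ae ?_
  filter_upwards [h] with x hx
  rw [hx]

lemma fourierIntegral_sub (G : K → ℂ) (a ξ : K) :
    fourierIntegral S μ (fun x => G (x - a)) ξ = S.χ (-(a * ξ)) * fourierIntegral S μ G ξ := by
  rw [fourierIntegral, ← integral_add_right_eq_self _ a, fourierIntegral, ← integral_const_mul]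
  refine integral_congr_ae (Eventually.of_forall fun x => ?_)
  simp only [add_sub_cancel_right]
  rw [show -(ξ * (x + a)) = -(a * ξ) + -(ξ * x) by ring, S.χ_add]
  ring

lemma fourierIntegral_π_inv_mul (hμ : μ (integers K) = 1) (G : K → ℂ) (ξ : K) :
    fourierIntegral S μ (fun x => (Real.sqrt S.q : ℂ) * G (S.π⁻¹ * x)) ξ =
      (((Real.sqrt S.q)⁻¹ : ℝ) : ℂ) * fourierIntegral S μ G (S.π * ξ) := by
  have h := integral_π_mul S μ hμ
    (fun x => (Real.sqrt S.q : ℂ) * G (S.π⁻¹ * x) * (S.χ (-(ξ * x)) : ℂ))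
  have h2 : fourierIntegral S μ (fun x => (Real.sqrt S.q : ℂ) * G (S.π⁻¹ * x)) ξ =
      (S.q : ℂ)⁻¹ * ∫ x, (Real.sqrt S.q : ℂ) * G x * (S.χ (-(ξ * (S.π * x))) : ℂ) ∂μ := by
    simp only [inv_mul_cancel_left₀ S.π_ne_zero] at h
    rw [h, inv_mul_cancel_left₀ (Nat.cast_ne_zero.mpr S.q_pos.ne')]
    rfl
  have h3 : (S.q : ℂ)⁻¹ * (Real.sqrt S.q : ℂ) = (((Real.sqrt S.q)⁻¹ : ℝ) : ℂ) := by
    have h4 : ((S.q : ℝ) : ℂ) = (Real.sqrt S.q : ℂ) * (Real.sqrt S.q : ℂ) := by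
      rw [← Complex.ofReal_mul, Real.mul_self_sqrt (Nat.cast_nonneg _)]
    have h5 : (Real.sqrt S.q : ℂ) ≠ 0 := Complex.ofReal_ne_zero.mpr (sqrt_q_ne_zero S)
    rw [← Complex.ofReal_natCast, h4, Complex.ofReal_inv]
    field_simp
  rw [h2, fourierIntegral, ← h3, mul_assoc, ← integral_const_mul (Real.sqrt S.q : ℂ)]
  congr 1
  refine integral_congr_ae (Eventually.of_forall fun x => ?_)
  simp only
  rw [show -(ξ * (S.π * x)) = -(S.π * ξ * x) by ring]
  ring

lemma integrable_comp_mul (a : K) (ha : a ≠ 0) {G : K → ℂ} (hG : Integrable G μ) :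
    Integrable (fun x => G (a * x)) μ := by
  obtain ⟨C, hC, h⟩ := exists_map_mul μ a ha
  have h1 : Integrable G (μ.map fun x => a * x) := by
    rw [h]; exact hG.smul_measure hC
  exact (measurableEmbedding_mul ha).integrable_map_iff.mp h1

/-- Two continuous operators agree on `L²(K)` if they agree on `L¹ ∩ L²`. -/
lemma eq_of_eq_on_integrable (S : Setting K) {A B : Lp ℂ 2 μ → Lp ℂ 2 μ} (hA : Continuous A) (hB : Continuous B)
    (h : ∀ G : Lp ℂ 2 μ, Integrable G μ → A G = B G) (f : Lp ℂ 2 μ) : A f = B f := by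
  refine tendsto_nhds_unique ((hA.tendsto f).comp (tendsto_trunc S μ f)) ?_
  refine ((hB.tendsto f).comp (tendsto_trunc S μ f)).congr fun N => (h _ ?_).symm
  exact (integrable_trunc S μ N f).congr (memLp_trunc S μ N f).coeFn_toLp.symm

lemma fourierIntegral_coeFn_ae_eq (hμ : μ (integers K) = 1) (G : Lp ℂ 2 μ)
    (hG : Integrable G μ) : fourierIntegral S μ G =ᵐ[μ] plancherel S μ hμ G := by
  have h := fourierIntegral_ae_eq_plancherel S μ hμ hG (Lp.memLp G)
  rwa [Lp.toLp_coeFn] at h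

lemma plancherel_shift (hμ : μ (integers K) = 1) (a : K) (f : Lp ℂ 2 μ) :
    plancherel S μ hμ (shift μ a f) = modul S μ a (plancherel S μ hμ f) := by
  have hc : Continuous (shift μ a) :=
    (LinearIsometry.mk (shift μ a) (norm_shift μ a)).continuous
  refine eq_of_eq_on_integrable μ S (A := fun f => plancherel S μ hμ (shift μ a f))
    (B := fun f => modul S μ a (plancherel S μ hμ f)) ((plancherel S μ hμ).continuous.comp hc)
    ((modul S μ a).continuous.comp (plancherel S μ hμ).continuous) (fun G hG => ?_) f
  refine Lp.ext ?_
  have h1 := coeFn_shift μ a G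
  have h2 : Integrable (shift μ a G) μ :=
    ((measurePreserving_sub_right μ a).integrable_comp_of_integrable hG).congr h1.symm
  filter_upwards [fourierIntegral_coeFn_ae_eq S μ hμ _ h2,
    fourierIntegral_coeFn_ae_eq S μ hμ G hG, coeFn_modul S μ a (plancherel S μ hμ G)]
    with ξ h3 h4 h5
  rw [← h3, h5, ← h4, fourierIntegral_congr S μ h1, fourierIntegral_sub S μ G]

lemma plancherel_D (hμ : μ (integers K) = 1) (f : Lp ℂ 2 μ) :
    plancherel S μ hμ (D S μ f) = freqDil S μ hμ (plancherel S μ hμ f) := by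
  have hc : Continuous (D S μ) := (LinearIsometry.mk (D S μ) (norm_D S μ hμ)).continuous
  refine eq_of_eq_on_integrable μ S (A := fun f => plancherel S μ hμ (D S μ f))
    (B := fun f => freqDil S μ hμ (plancherel S μ hμ f)) ((plancherel S μ hμ).continuous.comp hc)
    ((freqDil S μ hμ).continuous.comp (plancherel S μ hμ).continuous) (fun G hG => ?_) f
  refine Lp.ext ?_
  have h1 := coeFn_D S μ G
  have h2 : Integrable (D S μ G) μ :=
    ((integrable_comp_mul μ _ (inv_ne_zero S.π_ne_zero) hG).const_mul _).congr h1.symm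
  filter_upwards [fourierIntegral_coeFn_ae_eq S μ hμ _ h2,
    (quasi_mul μ S.π S.π_ne_zero).ae (fourierIntegral_coeFn_ae_eq S μ hμ G hG),
    coeFn_freqDil S μ hμ (plancherel S μ hμ G)] with ξ h3 h4 h5
  rw [← h3, h5, ← h4, fourierIntegral_congr S μ h1, fourierIntegral_π_inv_mul S μ hμ G]

end Intertwining

/-! ### Brackets, invariant spaces and their fiberwise projections -/

section Bracket

variable {K : Type*} [NontriviallyNormedField K] [IsUltrametricDist K] [ProperSpace K]
  [MeasurableSpace K] [BorelSpace K] (S : Setting K) (μ : Measure K) [μ.IsAddHaarMeasure]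

lemma per_add_u (H : K → ℂ) (x : K) (k : ℕ) : per S H (x + S.u k) = per S H x := by
  obtain ⟨e, he⟩ := S.exists_equiv_u_add k
  rw [per, per, ← e.tsum_eq fun n => H (x + S.u n)]
  refine tsum_congr fun n => ?_
  rw [he, add_comm (S.u n), add_assoc]

/-- The bracket `[f, g](ξ) = ∑ₙ conj f(ξ + u(n)) g(ξ + u(n))`. -/
noncomputable def br (f g : K → ℂ) : K → ℂ := per S fun x => (starRingEnd ℂ) (f x) * g x

lemma br_apply (f g : K → ℂ) (ξ : K) :
    br S f g ξ = ∑' n, (starRingEnd ℂ) (f (ξ + S.u n)) * g (ξ + S.u n) := rfl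

lemma integrable_conj_mul (f g : Lp ℂ 2 μ) : Integrable (fun x => (starRingEnd ℂ) (f x) * g x) μ :=
  (L2.integrable_inner (𝕜 := ℂ) f g).congr (Eventually.of_forall fun _ => RCLike.inner_apply' _ _)

lemma inner_eq_integral (f g : Lp ℂ 2 μ) :
    inner ℂ f g = ∫ x, (starRingEnd ℂ) (f x) * g x ∂μ := by
  rw [L2.inner_def]
  exact integral_congr_ae (Eventually.of_forall fun _ => RCLike.inner_apply' _ _)

lemma br_congr {f f' g g' : K → ℂ} (hf : f =ᵐ[μ] f') (hg : g =ᵐ[μ] g') :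
    ∀ᵐ ξ ∂μ.restrict (integers K), br S f g ξ = br S f' g' ξ := by
  filter_upwards [(ae_iff_ae_fiber S μ).mp hf, (ae_iff_ae_fiber S μ).mp hg] with ξ h1 h2
  refine tsum_congr fun n => ?_
  simp only [h1, h2]

lemma br_mul_left {c : K → ℂ} (f g : K → ℂ) {ξ : K} (hc : ∀ n, c (ξ + S.u n) = c ξ) :
    br S (fun x => c x * f x) g ξ = (starRingEnd ℂ) (c ξ) * br S f g ξ := by
  rw [br_apply, br_apply, ← tsum_mul_left]
  refine tsum_congr fun n => ?_
  rw [hc, map_mul, mul_assoc]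

lemma br_mul_right {c : K → ℂ} (f g : K → ℂ) {ξ : K} (hc : ∀ n, c (ξ + S.u n) = c ξ) :
    br S f (fun x => c x * g x) ξ = c ξ * br S f g ξ := by
  rw [br_apply, br_apply, ← tsum_mul_left]
  refine tsum_congr fun n => ?_
  rw [hc]
  ring

/-- The normalization of `χ` on `𝒵` enters here: modulation factors are constant along fibers and
can be taken out of brackets. -/
lemma χ_neg_u_mul_add (k n : ℕ) (ξ : K) :
    (S.χ (-(S.u k * (ξ + S.u n))) : ℂ) = S.χ (-(S.u k * ξ)) := by
  rw [AddChar.map_neg_eq_inv, AddChar.map_neg_eq_inv, S.χ_u_mul_add]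

lemma br_modul_left (k : ℕ) (f g : Lp ℂ 2 μ) : ∀ᵐ ξ ∂μ.restrict (integers K),
    br S (modul S μ (S.u k) f) g ξ = S.χ (S.u k * ξ) * br S f g ξ := by
  filter_upwards [br_congr S μ (coeFn_modul S μ (S.u k) f) (ae_eq_refl g)] with ξ h
  rw [h, br_mul_left S f g (c := fun ξ => (S.χ (-(S.u k * ξ)) : ℂ))
    fun n => χ_neg_u_mul_add S k n ξ, S.conj_χ, neg_neg]

lemma br_modul_right (k : ℕ) (f g : Lp ℂ 2 μ) : ∀ᵐ ξ ∂μ.restrict (integers K),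
    br S f (modul S μ (S.u k) g) ξ = S.χ (-(S.u k * ξ)) * br S f g ξ := by
  filter_upwards [br_congr S μ (ae_eq_refl f) (coeFn_modul S μ (S.u k) g)] with ξ h
  rw [h, br_mul_right S f g (c := fun ξ => (S.χ (-(S.u k * ξ)) : ℂ))
    fun n => χ_neg_u_mul_add S k n ξ]

lemma inner_eq_setIntegral_br (f g : Lp ℂ 2 μ) :
    inner ℂ f g = ∫ ξ in integers K, br S f g ξ ∂μ := by
  rw [inner_eq_integral, ← setIntegral_per S μ (integrable_conj_mul μ f g)]
  rfl

lemma inner_modul_left (k : ℕ) (f g : Lp ℂ 2 μ) :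
    inner ℂ (modul S μ (S.u k) f) g =
      ∫ ξ in integers K, (S.χ (S.u k * ξ) : ℂ) * br S f g ξ ∂μ := by
  rw [inner_eq_setIntegral_br S]
  exact integral_congr_ae (br_modul_left S μ k f g)

/-- The bracket of two functions vanishes if the modulations of the first one are orthogonal to
the second one. -/
lemma br_eq_zero {f g : Lp ℂ 2 μ} (h : ∀ k, inner ℂ (modul S μ (S.u k) f) g = 0) :
    ∀ᵐ ξ ∂μ.restrict (integers K), br S f g ξ = 0 :=
  -- The given inner products are exactly the Fourier coefficients of the bracket.
  ae_eq_zero_of_setIntegral_χ_mul S μ (integrableOn_per S μ (integrable_conj_mul μ f g))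
    fun k => by rw [← h k, inner_modul_left]

lemma inner_modul_left_eq_zero {f g : Lp ℂ 2 μ}
    (h : ∀ᵐ ξ ∂μ.restrict (integers K), br S f g ξ = 0) (k : ℕ) :
    inner ℂ (modul S μ (S.u k) f) g = 0 := by
  rw [inner_modul_left]
  refine integral_eq_zero_of_ae ?_
  filter_upwards [h] with ξ hξ
  simp [hξ]

lemma inner_eq_zero_of_br {f g : Lp ℂ 2 μ}
    (h : ∀ᵐ ξ ∂μ.restrict (integers K), br S f g ξ = 0) : inner ℂ f g = 0 := by
  rw [inner_eq_setIntegral_br S]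
  exact integral_eq_zero_of_ae h

lemma br_swap (f g : K → ℂ) (ξ : K) : br S g f ξ = (starRingEnd ℂ) (br S f g ξ) := by
  rw [br_apply, br_apply, Complex.conj_tsum]
  refine tsum_congr fun n => ?_
  simp [mul_comm]

lemma br_sub_right (f g h : Lp ℂ 2 μ) : ∀ᵐ ξ ∂μ.restrict (integers K),
    br S f (g - h : Lp ℂ 2 μ) ξ = br S f g ξ - br S f h ξ := by
  filter_upwards [br_congr S μ (ae_eq_refl f) (Lp.coeFn_sub g h),
    ae_summable_fiber S μ (integrable_conj_mul μ f g),
    ae_summable_fiber S μ (integrable_conj_mul μ f h)] with ξ h1 h2 h3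
  rw [h1, br_apply, br_apply, br_apply, ← h2.tsum_sub h3]
  refine tsum_congr fun n => ?_
  simp only [Pi.sub_apply, mul_sub]

/-- The squared norm of the fiber of `f` over `ξ`. -/
noncomputable def nrm (f : K → ℂ) (ξ : K) : ℝ≥0∞ := ∑' n, ‖f (ξ + S.u n)‖ₑ ^ (2 : ℝ)

lemma nrm_add_u (f : K → ℂ) (x : K) (k : ℕ) : nrm S f (x + S.u k) = nrm S f x := by
  obtain ⟨e, he⟩ := S.exists_equiv_u_add k
  rw [nrm, nrm, ← e.tsum_eq fun n => ‖f (x + S.u n)‖ₑ ^ (2 : ℝ)]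
  refine tsum_congr fun n => ?_
  rw [he, add_comm (S.u n), add_assoc]

lemma measurable_nrm {f : K → ℂ} (hf : Measurable f) : Measurable (nrm S f) :=
  Measurable.tsum fun _ => (hf.comp (measurable_add_const _)).enorm.pow_const _

lemma lintegral_nrm {f : K → ℂ} (hf : AEStronglyMeasurable f μ) :
    ∫⁻ ξ in integers K, nrm S f ξ ∂μ = ∫⁻ x, ‖f x‖ₑ ^ (2 : ℝ) ∂μ :=
  (lintegral_eq_lintegral_tsum S μ (hf.enorm.pow_const 2)).symm

lemma lintegral_enorm_rpow_lt_top (f : Lp ℂ 2 μ) : ∫⁻ x, ‖f x‖ₑ ^ (2 : ℝ) ∂μ < ∞ := by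
  have := (Lp.memLp f).2
  rw [eLpNorm_lt_top_iff_lintegral_rpow_enorm_lt_top (by norm_num) (by norm_num)] at this
  simpa using this

lemma memLp_of_lintegral_nrm {f : K → ℂ} (hf : AEStronglyMeasurable f μ)
    (h : ∫⁻ ξ in integers K, nrm S f ξ ∂μ < ∞) : MemLp f 2 μ := by
  refine ⟨hf, ?_⟩
  rw [eLpNorm_lt_top_iff_lintegral_rpow_enorm_lt_top (by norm_num) (by norm_num)]
  rw [lintegral_nrm S μ hf] at h
  simpa using h

lemma ae_nrm_lt_top (f : Lp ℂ 2 μ) : ∀ᵐ ξ ∂μ.restrict (integers K), nrm S f ξ < ∞ := by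
  refine ae_lt_top (measurable_nrm S (Lp.stronglyMeasurable f).measurable) ?_
  rw [lintegral_nrm S μ (Lp.aestronglyMeasurable f)]
  exact (lintegral_enorm_rpow_lt_top μ f).ne

lemma toReal_enorm_rpow_two (z : ℂ) : ((‖z‖ₑ ^ (2 : ℝ)).toReal : ℂ) = (starRingEnd ℂ) z * z := by
  rw [← ENNReal.toReal_rpow, toReal_enorm, Real.rpow_two, Complex.conj_mul']
  norm_cast

lemma br_self (f : K → ℂ) (ξ : K) : br S f f ξ = ((nrm S f ξ).toReal : ℂ) := by
  rw [nrm, ENNReal.tsum_toReal_eq fun n => ENNReal.rpow_ne_top_of_nonneg (by norm_num)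
    enorm_ne_top, Complex.ofReal_tsum, br_apply]
  simp only [toReal_enorm_rpow_two]

/-- A closed subspace of `L²(K)` that is invariant under the modulations by the `u(k)`. -/
structure IsModInvariant (X : Submodule ℂ (Lp ℂ 2 μ)) : Prop where
  isClosed : IsClosed (X : Set (Lp ℂ 2 μ))
  modul_mem : ∀ f ∈ X, ∀ k : ℕ, modul S μ (S.u k) f ∈ X

lemma inner_modul_right (a : K) (f g : Lp ℂ 2 μ) :
    inner ℂ f (modul S μ a g) = inner ℂ (modul S μ (-a) f) g := by
  rw [inner_eq_integral, inner_eq_integral]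
  refine integral_congr_ae ?_
  filter_upwards [coeFn_modul S μ a g, coeFn_modul S μ (-a) f] with x h1 h2
  rw [h1, h2, map_mul, S.conj_χ]
  ring_nf

variable {S μ}

lemma IsModInvariant.br_eq_zero {X : Submodule ℂ (Lp ℂ 2 μ)} (hX : IsModInvariant S μ X)
    {f g : Lp ℂ 2 μ} (hf : f ∈ X) (hg : g ∈ Xᗮ) :
    ∀ᵐ ξ ∂μ.restrict (integers K), br S f g ξ = 0 :=
  LFPC.br_eq_zero S μ fun k => Submodule.inner_right_of_mem_orthogonal (hX.modul_mem f hf k) hg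

/-- The inner product is the integral of the bracket, and `X = Xᗮᗮ` because `X` is closed. This is
how membership is checked after fiberwise operations, such as multiplication by a periodic function.
-/
lemma IsModInvariant.mem_of_br {X : Submodule ℂ (Lp ℂ 2 μ)} (hX : IsModInvariant S μ X)
    {f : Lp ℂ 2 μ} (h : ∀ g ∈ Xᗮ, ∀ᵐ ξ ∂μ.restrict (integers K), br S f g ξ = 0) : f ∈ X := by
  rw [← hX.isClosed.submodule_topologicalClosure_eq, ← Submodule.orthogonal_orthogonal_eq_closure,
    Submodule.mem_orthogonal']
  exact fun g hg => inner_eq_zero_of_br S μ (h g hg)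

lemma IsModInvariant.orthogonal {X : Submodule ℂ (Lp ℂ 2 μ)} (hX : IsModInvariant S μ X) :
    IsModInvariant S μ Xᗮ where
  isClosed := X.isClosed_orthogonal
  modul_mem f hf k := by
    rw [Submodule.mem_orthogonal]
    intro g hg
    obtain ⟨l, hl⟩ := S.exists_u_neg k
    rw [inner_modul_right, hl]
    exact Submodule.inner_right_of_mem_orthogonal (hX.modul_mem g hg l) hf

lemma IsModInvariant.inf {X Y : Submodule ℂ (Lp ℂ 2 μ)} (hX : IsModInvariant S μ X)
    (hY : IsModInvariant S μ Y) : IsModInvariant S μ (X ⊓ Y) where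
  isClosed := hX.isClosed.inter hY.isClosed
  modul_mem f hf k := ⟨hX.modul_mem f hf.1 k, hY.modul_mem f hf.2 k⟩

/-- The orthogonal projection onto the closure of `X`. -/
noncomputable def proj (X : Submodule ℂ (Lp ℂ 2 μ)) (f : Lp ℂ 2 μ) : Lp ℂ 2 μ :=
  X.topologicalClosure.starProjection f

lemma IsModInvariant.proj_mem {X : Submodule ℂ (Lp ℂ 2 μ)} (hX : IsModInvariant S μ X)
    (f : Lp ℂ 2 μ) : proj X f ∈ X :=
  hX.isClosed.submodule_topologicalClosure_eq.le
    (X.topologicalClosure.starProjection_apply_mem f)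

lemma sub_proj_mem (X : Submodule ℂ (Lp ℂ 2 μ)) (f : Lp ℂ 2 μ) : f - proj X f ∈ Xᗮ :=
  Submodule.orthogonal_le X.le_topologicalClosure
    (X.topologicalClosure.sub_starProjection_mem_orthogonal f)

lemma IsModInvariant.proj_eq {X : Submodule ℂ (Lp ℂ 2 μ)} (hX : IsModInvariant S μ X)
    {f g : Lp ℂ 2 μ} (hg : g ∈ X) (h : f - g ∈ Xᗮ) : proj X f = g := by
  refine Submodule.eq_starProjection_of_mem_orthogonal (X.le_topologicalClosure hg) ?_
  rwa [hX.isClosed.submodule_topologicalClosure_eq]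

lemma memLp_indicator {A : Set K} (hA : MeasurableSet A) (f : Lp ℂ 2 μ) :
    MemLp (A.indicator f) 2 μ := (Lp.memLp f).indicator hA

/-- Cutting off a function to a measurable set. -/
noncomputable def cut {A : Set K} (hA : MeasurableSet A) (f : Lp ℂ 2 μ) : Lp ℂ 2 μ :=
  (memLp_indicator hA f).toLp

lemma coeFn_cut {A : Set K} (hA : MeasurableSet A) (f : Lp ℂ 2 μ) :
    cut hA f =ᵐ[μ] A.indicator f := (memLp_indicator hA f).coeFn_toLp

lemma cut_sub {A : Set K} (hA : MeasurableSet A) (f g : Lp ℂ 2 μ) :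
    cut hA (f - g) = cut hA f - cut hA g := by
  refine Lp.ext ?_
  filter_upwards [coeFn_cut hA f, coeFn_cut hA g, coeFn_cut hA (f - g), Lp.coeFn_sub f g,
    Lp.coeFn_sub (cut hA f) (cut hA g)] with x h1 h2 h3 h4 h5
  rw [h3, h5, Pi.sub_apply, h1, h2]
  by_cases hx : x ∈ A
  · simp only [Set.indicator_of_mem hx, h4, Pi.sub_apply]
  · simp [hx]

/-- The indicator of a periodic set factors out of every bracket with `Xᗮ`. -/
lemma IsModInvariant.cut_mem {X : Submodule ℂ (Lp ℂ 2 μ)} (hX : IsModInvariant S μ X)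
    {A : Set K} (hA : MeasurableSet A) (hper : ∀ x n, x + S.u n ∈ A ↔ x ∈ A)
    {f : Lp ℂ 2 μ} (hf : f ∈ X) : cut hA f ∈ X := by
  refine hX.mem_of_br fun g hg => ?_
  have h1 : cut hA f =ᵐ[μ] fun x => A.indicator 1 x * f x := by
    filter_upwards [coeFn_cut hA f] with x hx
    rw [hx]
    by_cases hx : x ∈ A <;> simp [hx]
  filter_upwards [br_congr S μ h1 (ae_eq_refl g), hX.br_eq_zero hf hg] with ξ h2 h3
  rw [h2, br_mul_left S f g (c := A.indicator 1), h3, mul_zero]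
  intro n
  by_cases hx : ξ ∈ A
  · rw [Set.indicator_of_mem hx, Set.indicator_of_mem ((hper ξ n).mpr hx)]; rfl
  · rw [Set.indicator_of_notMem hx, Set.indicator_of_notMem (mt (hper ξ n).mp hx)]

lemma IsModInvariant.proj_cut {X : Submodule ℂ (Lp ℂ 2 μ)} (hX : IsModInvariant S μ X)
    {A : Set K} (hA : MeasurableSet A) (hper : ∀ x n, x + S.u n ∈ A ↔ x ∈ A)
    (f : Lp ℂ 2 μ) : proj X (cut hA f) = cut hA (proj X f) := by
  refine hX.proj_eq (hX.cut_mem hA hper (hX.proj_mem f)) ?_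
  rw [← cut_sub]
  exact hX.orthogonal.cut_mem hA hper (sub_proj_mem X f)

variable (S μ)

/-- The indicator function of the coset `u(n) + 𝒪`. -/
noncomputable def cosetLp (n : ℕ) : Lp ℂ 2 μ := waveLp S μ 0 n

lemma coeFn_cosetLp (n : ℕ) : cosetLp S μ n =ᵐ[μ] (S.coset n).indicator 1 := by
  filter_upwards [coeFn_waveLp S μ 0 n] with x hx
  rw [cosetLp, hx, wave]
  congr 1
  ext y
  simp

/-- The fiber of `cosetLp S μ n` is the `n`-th unit vector. -/
lemma cosetLp_fiber (n : ℕ) : ∀ᵐ ξ ∂μ.restrict (integers K),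
    ∀ m, cosetLp S μ n (ξ + S.u m) = if m = n then 1 else 0 := by
  filter_upwards [(ae_iff_ae_fiber S μ).mp (coeFn_cosetLp S μ n),
    ae_restrict_mem measurableSet_integers] with ξ h hξ m
  rw [h]
  by_cases hm : m = n
  · rw [Set.indicator_of_mem ((S.add_u_mem_coset_iff hξ).mpr hm), if_pos hm]; rfl
  · rw [Set.indicator_of_notMem (mt (S.add_u_mem_coset_iff hξ).mp hm), if_neg hm]

lemma br_cosetLp_left (n : ℕ) (f : K → ℂ) : ∀ᵐ ξ ∂μ.restrict (integers K),
    br S (cosetLp S μ n) f ξ = f (ξ + S.u n) := by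
  filter_upwards [cosetLp_fiber S μ n] with ξ h
  rw [br_apply, tsum_eq_single n]
  · simp [h]
  · intro m hm
    simp [h, hm]

/-- The diagonal entry `⟨P_ξ e_n, e_n⟩` of the projection of `ℓ²` onto the fiber of `X`. -/
noncomputable def diagEntry (X : Submodule ℂ (Lp ℂ 2 μ)) (n : ℕ) (ξ : K) : ℂ :=
  proj X (cosetLp S μ n) (ξ + S.u n)

variable {S μ}

/-- This is `⟨P e, e⟩ = ‖P e‖²` in each fiber, read off from the vanishing bracket of `P e` and `e -
P e`. In particular diagonal entries are nonnegative reals. -/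
lemma IsModInvariant.diagEntry_eq {X : Submodule ℂ (Lp ℂ 2 μ)} (hX : IsModInvariant S μ X)
    (n : ℕ) : ∀ᵐ ξ ∂μ.restrict (integers K),
      diagEntry S μ X n ξ = ((nrm S (proj X (cosetLp S μ n)) ξ).toReal : ℂ) := by
  filter_upwards [hX.br_eq_zero (hX.proj_mem (cosetLp S μ n)) (sub_proj_mem X (cosetLp S μ n)),
    br_sub_right S μ (proj X (cosetLp S μ n)) (cosetLp S μ n) (proj X (cosetLp S μ n)),
    br_cosetLp_left S μ n (proj X (cosetLp S μ n))] with ξ h1 h2 h3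
  rw [h1, br_self, br_swap, h3, eq_comm, sub_eq_zero] at h2
  rw [diagEntry, ← Complex.conj_conj (proj X (cosetLp S μ n) (ξ + S.u n)), h2, Complex.conj_ofReal]

/-- Diagonal entries are additive on orthogonal sums. -/
lemma IsModInvariant.diagEntry_inf_orthogonal {X Y : Submodule ℂ (Lp ℂ 2 μ)}
    (hX : IsModInvariant S μ X) (hY : IsModInvariant S μ Y) (hYX : Y ≤ X) (n : ℕ) :
    ∀ᵐ ξ ∂μ.restrict (integers K),
      diagEntry S μ (X ⊓ Yᗮ) n ξ = diagEntry S μ X n ξ - diagEntry S μ Y n ξ := by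
  have h : proj (X ⊓ Yᗮ) (cosetLp S μ n) =
      proj X (cosetLp S μ n) - proj Y (cosetLp S μ n) := by
    refine (hX.inf hY.orthogonal).proj_eq ⟨?_, ?_⟩ ?_
    · exact X.sub_mem (hX.proj_mem _) (hYX (hY.proj_mem _))
    · have := Yᗮ.sub_mem (sub_proj_mem Y (cosetLp S μ n))
        (Submodule.orthogonal_le hYX (sub_proj_mem X (cosetLp S μ n)))
      rwa [sub_sub_sub_cancel_left] at this
    · rw [sub_sub_eq_add_sub, add_sub_right_comm]
      refine Submodule.add_mem _ ?_ ?_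
      · exact Submodule.orthogonal_le inf_le_left (sub_proj_mem X (cosetLp S μ n))
      · refine Submodule.orthogonal_le inf_le_right ?_
        exact Submodule.le_orthogonal_orthogonal Y (hY.proj_mem _)
  filter_upwards [(ae_iff_ae_fiber S μ).mp (Lp.coeFn_sub (proj X (cosetLp S μ n))
    (proj Y (cosetLp S μ n)))] with ξ hξ
  rw [diagEntry, h, hξ]
  rfl

end Bracket

/-! ### The trace of a dilated space -/

/-- Summation along the residue classes modulo `q`. -/
lemma hasSum_of_residues {q : ℕ} {f t : ℕ → ℂ}
    (h : ∀ d < q, HasSum (fun n => f (d + q * n)) (t d)) (hq : 0 < q) :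
    HasSum f (∑ d ∈ Finset.range q, t d) := by
  have h1 : ∀ d ∈ Finset.range q, HasSum (fun n => if n % q = d then f n else 0) (t d) := by
    intro d hd
    have hd' := Finset.mem_range.mp hd
    have hinj : Function.Injective fun n => d + q * n := fun a b hab =>
      Nat.eq_of_mul_eq_mul_left hq (Nat.add_left_cancel hab)
    rw [← hinj.hasSum_iff]
    · convert h d hd' using 2 with n
      simp [Nat.add_mul_mod_self_left, Nat.mod_eq_of_lt hd']
    · intro n hn
      refine if_neg fun hnd => hn ⟨n / q, ?_⟩
      simp only
      rw [← hnd]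
      exact Nat.mod_add_div n q
  convert hasSum_sum h1 using 2 with n
  rw [Finset.sum_ite_eq, if_pos (Finset.mem_range.mpr (Nat.mod_lt n hq))]

section Trace

variable {K : Type*} [NontriviallyNormedField K] [IsUltrametricDist K] [ProperSpace K]
  [MeasurableSpace K] [BorelSpace K] {S : Setting K} {μ : Measure K} [μ.IsAddHaarMeasure]

lemma Setting.π_mul_u_mul (k : ℕ) : S.u (S.q * k) * S.π = S.u k := by
  have h := S.u_add_mul S.q_pos k
  rw [zero_add, S.u_zero, zero_add] at h
  rw [h, mul_comm, mul_inv_cancel_left₀ S.π_ne_zero]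

lemma modul_freqDil (hμ : μ (integers K) = 1) (k : ℕ) (f : Lp ℂ 2 μ) :
    modul S μ (S.u k) (freqDil S μ hμ f) = freqDil S μ hμ (modul S μ (S.u (S.q * k)) f) := by
  refine Lp.ext ?_
  filter_upwards [coeFn_modul S μ (S.u k) (freqDil S μ hμ f), coeFn_freqDil S μ hμ f,
    coeFn_freqDil S μ hμ (modul S μ (S.u (S.q * k)) f),
    (quasi_mul μ S.π S.π_ne_zero).ae (coeFn_modul S μ (S.u (S.q * k)) f)] with x h1 h2 h3 h4
  rw [h1, h2, h3, h4, ← mul_assoc (S.u (S.q * k)), S.π_mul_u_mul]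
  ring

lemma IsModInvariant.map_freqDil {X : Submodule ℂ (Lp ℂ 2 μ)} (hX : IsModInvariant S μ X)
    (hμ : μ (integers K) = 1) :
    IsModInvariant S μ (X.map (freqDil S μ hμ).toLinearMap) where
  isClosed := by
    rw [Submodule.map_coe]
    exact (freqDil S μ hμ).isometry.isClosedEmbedding.isClosedMap _ hX.isClosed
  modul_mem := by
    rintro _ ⟨f, hf, rfl⟩ k
    exact ⟨_, hX.modul_mem f hf (S.q * k), (modul_freqDil hμ k f).symm⟩

lemma IsModInvariant.proj_freqDil {X : Submodule ℂ (Lp ℂ 2 μ)} (hX : IsModInvariant S μ X)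
    (hμ : μ (integers K) = 1) (f : Lp ℂ 2 μ) :
    proj (X.map (freqDil S μ hμ).toLinearMap) (freqDil S μ hμ f) = freqDil S μ hμ (proj X f) := by
  refine (hX.map_freqDil hμ).proj_eq ⟨_, hX.proj_mem f, rfl⟩ ?_
  rw [← map_sub, Submodule.mem_orthogonal]
  rintro _ ⟨g, hg, rfl⟩
  exact ((freqDil S μ hμ).inner_map_map _ _).trans
    (Submodule.inner_right_of_mem_orthogonal hg (sub_proj_mem X f))

variable (S) in
/-- The union of the translates by the `u(m)` of the ball `π (u(d) + 𝒪)`. -/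
def dilCoset (d : ℕ) : Set K := ⋃ m, {x | ‖S.π⁻¹ * (x - S.u m) - S.u d‖ ≤ 1}

lemma measurableSet_dilCoset (d : ℕ) : MeasurableSet (dilCoset S d) :=
  MeasurableSet.iUnion fun _ =>
    (isClosed_le (by fun_prop) continuous_const : IsClosed _).measurableSet

lemma add_u_mem_dilCoset (d : ℕ) (x : K) (n : ℕ) :
    x + S.u n ∈ dilCoset S d ↔ x ∈ dilCoset S d := by
  simp only [dilCoset, Set.mem_iUnion, Set.mem_ofPred_eq]
  constructor
  · rintro ⟨m, hm⟩
    obtain ⟨k, hk⟩ := S.exists_u_sub m n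
    refine ⟨k, ?_⟩
    rwa [← hk, show x - (S.u m - S.u n) = x + S.u n - S.u m by ring]
  · rintro ⟨m, hm⟩
    obtain ⟨k, hk⟩ := S.exists_u_add m n
    refine ⟨k, ?_⟩
    rwa [← hk, add_sub_add_right_eq_sub]

/-- The splitting of cosets under dilation. -/
lemma mem_coset_add_mul_iff {d : ℕ} (hd : d < S.q) (n : ℕ) (x : K) :
    x ∈ S.coset (d + S.q * n) ↔ S.π * x ∈ dilCoset S d ∧ S.π * x ∈ S.coset n := by
  have key : ∀ m, ‖S.π⁻¹ * (S.π * x - S.u m) - S.u d‖ ≤ 1 ↔ x ∈ S.coset (d + S.q * m) := by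
    intro m
    rw [S.mem_coset, S.u_add_mul hd, mul_sub, inv_mul_cancel_left₀ S.π_ne_zero]
    ring_nf
  have hsub : ∀ m, x ∈ S.coset (d + S.q * m) → S.π * x ∈ S.coset m := by
    intro m hm
    rw [← key] at hm
    have h1 : ‖S.π * (S.π⁻¹ * (S.π * x - S.u m) - S.u d)‖ ≤ 1 := by
      rw [norm_mul]
      exact mul_le_one₀ S.norm_π_lt.le (norm_nonneg _) hm
    have h2 := Setting.norm_add_le_one h1 (S.norm_π_mul_u_le hd)
    rwa [mul_sub, mul_inv_cancel_left₀ S.π_ne_zero, sub_add_cancel] at h2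
  constructor
  · intro h
    exact ⟨Set.mem_iUnion.mpr ⟨n, (key n).mpr h⟩, hsub n h⟩
  · rintro ⟨h1, h2⟩
    obtain ⟨m, hm⟩ := Set.mem_iUnion.mp h1
    have hm' := (key m).mp hm
    rwa [S.eq_of_mem_coset h2 (hsub m hm')]

/-- Multiplication by `π` carries `u(d + qn) + 𝒪` onto the part of `u(n) + 𝒪` inside the periodic
set `dilCoset S d`; the factor `√q` undoes the normalization of `freqDil`. Periodicity is what
matters: such a cutoff commutes with projections onto invariant spaces. -/
lemma cosetLp_eq_freqDil (hμ : μ (integers K) = 1) {d : ℕ} (hd : d < S.q) (n : ℕ) :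
    cosetLp S μ (d + S.q * n) = freqDil S μ hμ
      ((Real.sqrt S.q : ℂ) • cut (measurableSet_dilCoset (S := S) d) (cosetLp S μ n)) := by
  refine Lp.ext ?_
  rw [map_smul]
  filter_upwards [coeFn_cosetLp S μ (d + S.q * n),
    Lp.coeFn_smul (Real.sqrt S.q : ℂ) (freqDil S μ hμ
      (cut (measurableSet_dilCoset (S := S) d) (cosetLp S μ n))),
    coeFn_freqDil S μ hμ (cut (measurableSet_dilCoset (S := S) d) (cosetLp S μ n)),
    (quasi_mul μ S.π S.π_ne_zero).ae
      (coeFn_cut (measurableSet_dilCoset (S := S) d) (cosetLp S μ n)),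
    (quasi_mul μ S.π S.π_ne_zero).ae (coeFn_cosetLp S μ n)] with x h1 h2 h3 h4 h5
  have hq : (Real.sqrt S.q : ℂ) ≠ 0 := Complex.ofReal_ne_zero.mpr (sqrt_q_ne_zero S)
  rw [h1, h2, Pi.smul_apply, h3, h4, smul_eq_mul, Complex.ofReal_inv, mul_inv_cancel_left₀ hq]
  by_cases hA : S.π * x ∈ dilCoset S d
  · rw [Set.indicator_of_mem hA, h5]
    by_cases hx : S.π * x ∈ S.coset n
    · rw [Set.indicator_of_mem ((mem_coset_add_mul_iff hd n x).mpr ⟨hA, hx⟩),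
        Set.indicator_of_mem hx]
      rfl
    · rw [Set.indicator_of_notMem fun h => hx ((mem_coset_add_mul_iff hd n x).mp h).2,
        Set.indicator_of_notMem hx]
  · rw [Set.indicator_of_notMem fun h => hA ((mem_coset_add_mul_iff hd n x).mp h).1,
      Set.indicator_of_notMem hA]

lemma proj_smul (X : Submodule ℂ (Lp ℂ 2 μ)) (r : ℂ) (f : Lp ℂ 2 μ) :
    proj X (r • f) = r • proj X f := map_smul _ _ _

/-- The diagonal entries of a dilated space. -/
lemma IsModInvariant.diagEntry_map_freqDil {X : Submodule ℂ (Lp ℂ 2 μ)}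
    (hX : IsModInvariant S μ X) (hμ : μ (integers K) = 1) {d : ℕ} (hd : d < S.q) (n : ℕ) :
    ∀ᵐ ξ ∂μ.restrict (integers K),
      diagEntry S μ (X.map (freqDil S μ hμ).toLinearMap) (d + S.q * n) ξ =
        diagEntry S μ X n (S.π * (ξ + S.u d)) := by
  have hA := measurableSet_dilCoset (S := S) d
  have h : proj (X.map (freqDil S μ hμ).toLinearMap) (cosetLp S μ (d + S.q * n)) =
      (Real.sqrt S.q : ℂ) • freqDil S μ hμ (cut hA (proj X (cosetLp S μ n))) := by
    rw [cosetLp_eq_freqDil hμ hd, hX.proj_freqDil, proj_smul,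
      hX.proj_cut hA (add_u_mem_dilCoset d), map_smul]
  have h1 : ∀ᵐ x ∂μ, proj (X.map (freqDil S μ hμ).toLinearMap) (cosetLp S μ (d + S.q * n)) x =
      (dilCoset S d).indicator (proj X (cosetLp S μ n)) (S.π * x) := by
    rw [h]
    filter_upwards [Lp.coeFn_smul (Real.sqrt S.q : ℂ)
        (freqDil S μ hμ (cut hA (proj X (cosetLp S μ n)))),
      coeFn_freqDil S μ hμ (cut hA (proj X (cosetLp S μ n))),
      (quasi_mul μ S.π S.π_ne_zero).ae (coeFn_cut hA (proj X (cosetLp S μ n)))] with x h2 h3 h4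
    have hq : (Real.sqrt S.q : ℂ) ≠ 0 := Complex.ofReal_ne_zero.mpr (sqrt_q_ne_zero S)
    rw [h2, Pi.smul_apply, h3, h4, smul_eq_mul, Complex.ofReal_inv, mul_inv_cancel_left₀ hq]
  filter_upwards [(ae_iff_ae_fiber S μ).mp h1, ae_restrict_mem measurableSet_integers]
    with ξ h2 hξ
  have hmem := ((mem_coset_add_mul_iff hd n _).mp (S.add_u_mem_coset (n := d + S.q * n) hξ)).1
  rw [diagEntry, h2, Set.indicator_of_mem hmem, diagEntry, S.u_add_mul hd]
  congr 1
  rw [← add_assoc, mul_add S.π (ξ + S.u d), mul_inv_cancel_left₀ S.π_ne_zero]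

/-- If a property holds almost everywhere on `𝒪`, then it holds at the points `π (ξ + u(d))`. -/
lemma ae_π_mul_add_u {P : K → Prop} (h : ∀ᵐ ξ ∂μ.restrict (integers K), P ξ) :
    ∀ᵐ ξ ∂μ.restrict (integers K), ∀ d < S.q, P (S.π * (ξ + S.u d)) := by
  rw [ae_restrict_iff' measurableSet_integers] at h
  filter_upwards [(ae_iff_ae_fiber S μ).mp ((quasi_mul μ S.π S.π_ne_zero).ae h),
    ae_restrict_mem measurableSet_integers] with ξ h1 hξ d hd
  refine h1 d ?_
  have h2 : ‖S.π * ξ‖ ≤ 1 := by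
    rw [norm_mul]
    exact mul_le_one₀ S.norm_π_lt.le (norm_nonneg _) hξ
  have := Setting.norm_add_le_one h2 (S.norm_π_mul_u_le hd)
  rwa [← mul_add] at this

/-- The indices congruent to `d` modulo `q` contribute the whole trace of `X` at `π(ξ + u(d))`. -/
lemma IsModInvariant.hasSum_diagEntry_map_freqDil {X : Submodule ℂ (Lp ℂ 2 μ)}
    (hX : IsModInvariant S μ X) (hμ : μ (integers K) = 1) {t : K → ℂ}
    (h : ∀ᵐ ξ ∂μ.restrict (integers K), HasSum (fun n => diagEntry S μ X n ξ) (t ξ)) :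
    ∀ᵐ ξ ∂μ.restrict (integers K),
      HasSum (fun n => diagEntry S μ (X.map (freqDil S μ hμ).toLinearMap) n ξ)
        (∑ d ∈ Finset.range S.q, t (S.π * (ξ + S.u d))) := by
  have h1 : ∀ᵐ ξ ∂μ.restrict (integers K), ∀ d, d < S.q → ∀ n,
      diagEntry S μ (X.map (freqDil S μ hμ).toLinearMap) (d + S.q * n) ξ =
        diagEntry S μ X n (S.π * (ξ + S.u d)) := by
    rw [ae_all_iff]
    intro d
    by_cases hd : d < S.q
    · filter_upwards [ae_all_iff.mpr (hX.diagEntry_map_freqDil hμ hd)] with ξ hξ _ using hξ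
    · exact Eventually.of_forall fun ξ h => absurd h hd
  filter_upwards [h1, ae_π_mul_add_u (S := S) h] with ξ h2 h3
  refine hasSum_of_residues (fun d hd => ?_) S.q_pos
  simp only [h2 d hd]
  exact h3 d hd

/-! ### Orthonormal generators of a space of constant trace -/

lemma nrm_congr {f g : K → ℂ} (h : f =ᵐ[μ] g) :
    ∀ᵐ ξ ∂μ.restrict (integers K), nrm S f ξ = nrm S g ξ := by
  filter_upwards [(ae_iff_ae_fiber S μ).mp h] with ξ h1
  refine tsum_congr fun n => ?_
  rw [h1]

lemma nrm_mul {c : K → ℂ} (f : K → ℂ) {ξ : K} (hc : ∀ n, c (ξ + S.u n) = c ξ) :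
    nrm S (fun x => c x * f x) ξ = ‖c ξ‖ₑ ^ (2 : ℝ) * nrm S f ξ := by
  rw [nrm, nrm, ← ENNReal.tsum_mul_left]
  refine tsum_congr fun n => ?_
  rw [hc, enorm_mul, ENNReal.mul_rpow_of_nonneg _ _ (by norm_num)]

lemma enorm_inv_sqrt_rpow_mul {a : ℝ≥0∞} (h0 : a ≠ 0) (h1 : a ≠ ∞) :
    ‖(((Real.sqrt a.toReal)⁻¹ : ℝ) : ℂ)‖ₑ ^ (2 : ℝ) * a = 1 := by
  have hpos : 0 < a.toReal := ENNReal.toReal_pos h0 h1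
  rw [← ofReal_norm, Complex.norm_real,
    Real.norm_of_nonneg (inv_nonneg.mpr (Real.sqrt_nonneg _)),
    ENNReal.ofReal_rpow_of_nonneg (inv_nonneg.mpr (Real.sqrt_nonneg _)) (by norm_num),
    Real.rpow_two, inv_pow, Real.sq_sqrt hpos.le, ENNReal.ofReal_inv_of_pos hpos,
    ENNReal.ofReal_toReal h1, ENNReal.inv_mul_cancel h0 h1]

/-- If almost all fibers of `X` are nontrivial, then `X` has a member all of whose fibers are
unit vectors. -/
lemma IsModInvariant.exists_nrm_eq_one {X : Submodule ℂ (Lp ℂ 2 μ)} (hX : IsModInvariant S μ X)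
    (h : ∀ᵐ ξ ∂μ.restrict (integers K), ∃ n, diagEntry S μ X n ξ ≠ 0) :
    ∃ ψ ∈ X, ∀ᵐ ξ ∂μ.restrict (integers K), nrm S ψ ξ = 1 := by
  classical
  let p : ℕ → Lp ℂ 2 μ := fun n => proj X (cosetLp S μ n)
  have hpm : ∀ n, Measurable (p n) := fun n => (Lp.stronglyMeasurable (p n)).measurable
  let E : ℕ → Set K := fun n => {x | nrm S (p n) x ≠ 0 ∧ nrm S (p n) x ≠ ∞}
  have hEm : ∀ n, MeasurableSet (E n) := fun n =>
    ((measurable_nrm S (hpm n)) (measurableSet_singleton 0).compl).inter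
      ((measurable_nrm S (hpm n)) (measurableSet_singleton ∞).compl)
  have hEper : ∀ n x k, x + S.u k ∈ E n ↔ x ∈ E n := fun n x k => by
    simp only [E, Set.mem_ofPred_eq, nrm_add_u]
  -- The second alternative makes the least admissible index defined at every point. This index is a
  -- measurable and periodic choice of a nonzero `P_ξ e_n`.
  let P : ℕ → K → Prop := fun n x => x ∈ E n ∨ ∀ m, x ∉ E m
  have hPm : ∀ n, MeasurableSet {x | P n x} := fun n => by
    have : {x | P n x} = E n ∪ ⋂ m, (E m)ᶜ := by
      ext x
      simp [P]
    rw [this]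
    exact (hEm n).union (MeasurableSet.iInter fun m => (hEm m).compl)
  have hP : ∀ x, ∃ n, P n x := fun x => by
    by_cases hx : ∃ n, x ∈ E n
    · exact hx.imp fun n hn => Or.inl hn
    · exact ⟨0, Or.inr fun m hm => hx ⟨m, hm⟩⟩
  have hfind : ∀ x k, Nat.find (hP (x + S.u k)) = Nat.find (hP x) := fun x k =>
    Nat.find_congr' fun {n} => by simp only [P, hEper]
  -- The inverse norm of the selected fiber; it is periodic, so multiplying by it rescales whole
  -- fibers.
  let c : K → ℂ := fun x =>
    (((Real.sqrt (nrm S (p (Nat.find (hP x))) x).toReal)⁻¹ : ℝ) : ℂ)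
  let φ : K → ℂ := fun x => p (Nat.find (hP x)) x
  have hcper : ∀ x k, c (x + S.u k) = c x := fun x k => by
    simp only [c, hfind, nrm_add_u]
  have hcm : Measurable c := by
    refine Complex.measurable_ofReal.comp (Measurable.inv (Real.continuous_sqrt.measurable.comp
      (ENNReal.measurable_toReal.comp ?_)))
    exact Measurable.find (fun n => measurable_nrm S (hpm n)) hPm hP
  have hφm : Measurable φ := Measurable.find hpm hPm hP
  have hφbr : ∀ g ξ, br S φ g ξ = br S (p (Nat.find (hP ξ))) g ξ := fun g ξ => by
    simp only [br_apply, φ, hfind]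
  have hφnrm : ∀ ξ, nrm S φ ξ = nrm S (p (Nat.find (hP ξ))) ξ := fun ξ => by
    simp only [nrm, φ, hfind]
  have hnrm : ∀ᵐ ξ ∂μ.restrict (integers K), nrm S (fun x => c x * φ x) ξ = 1 := by
    filter_upwards [h, ae_all_iff.mpr fun n => hX.diagEntry_eq n,
      ae_all_iff.mpr fun n => ae_nrm_lt_top S μ (p n)] with ξ ⟨n, hn⟩ h1 h2
    have hξ : ξ ∈ E n := by
      refine ⟨fun h0 => hn ?_, (h2 n).ne⟩
      rw [h1, show nrm S (proj X (cosetLp S μ n)) ξ = 0 from h0]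
      simp
    have hν : ξ ∈ E (Nat.find (hP ξ)) :=
      (Nat.find_spec (hP ξ)).resolve_right fun h3 => h3 n hξ
    rw [nrm_mul φ (hcper ξ), hφnrm]
    exact enorm_inv_sqrt_rpow_mul hν.1 hν.2
  -- Unit fibers integrate to the measure of `𝒪`, which is finite.
  have hmem : MemLp (fun x => c x * φ x) 2 μ := by
    refine memLp_of_lintegral_nrm S μ (hcm.mul hφm).aestronglyMeasurable ?_
    rw [lintegral_congr_ae hnrm]
    simpa using isCompact_integers.measure_lt_top
  refine ⟨hmem.toLp, hX.mem_of_br fun g hg => ?_, ?_⟩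
  · filter_upwards [br_congr S μ hmem.coeFn_toLp (ae_eq_refl g),
      ae_all_iff.mpr fun n => hX.br_eq_zero (hX.proj_mem (cosetLp S μ n)) hg] with ξ h1 h2
    rw [h1, br_mul_left S φ g (hcper ξ), hφbr, h2, mul_zero]
  · filter_upwards [nrm_congr (S := S) hmem.coeFn_toLp, hnrm] with ξ h1 h2
    rw [h1, h2]

lemma modul_modul (a b : K) (f : Lp ℂ 2 μ) :
    modul S μ a (modul S μ b f) = modul S μ (a + b) f := by
  refine Lp.ext ?_
  filter_upwards [coeFn_modul S μ a (modul S μ b f), coeFn_modul S μ b f,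
    coeFn_modul S μ (a + b) f] with x h1 h2 h3
  rw [h1, h2, h3, show -((a + b) * x) = -(a * x) + -(b * x) by ring, S.χ_add, mul_assoc]

variable (S) in
/-- The invariant space generated by `ψ`. -/
noncomputable def principal (ψ : Lp ℂ 2 μ) : Submodule ℂ (Lp ℂ 2 μ) :=
  (Submodule.span ℂ (Set.range fun k => modul S μ (S.u k) ψ)).topologicalClosure

lemma modul_mem_principal (ψ : Lp ℂ 2 μ) (k : ℕ) : modul S μ (S.u k) ψ ∈ principal S ψ :=
  Submodule.le_topologicalClosure _ (Submodule.subset_span ⟨k, rfl⟩)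

lemma mem_principal (ψ : Lp ℂ 2 μ) : ψ ∈ principal S ψ := by
  have h := modul_mem_principal (S := S) ψ 0
  have h2 : modul S μ (S.u 0) ψ = ψ := by
    refine Lp.ext ?_
    filter_upwards [coeFn_modul S μ (S.u 0) ψ] with x hx
    rw [hx, S.u_zero, zero_mul, neg_zero, S.χ_zero, one_mul]
  rwa [h2] at h

lemma isModInvariant_principal (ψ : Lp ℂ 2 μ) : IsModInvariant S μ (principal S ψ) where
  isClosed := Submodule.isClosed_topologicalClosure _
  modul_mem f hf k := by
    refine map_mem_closure (modul S μ (S.u k)).continuous hf fun g hg => ?_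
    have h : (Submodule.span ℂ (Set.range fun k => modul S μ (S.u k) ψ)).map
        (modul S μ (S.u k)).toLinearMap ≤
        Submodule.span ℂ (Set.range fun k => modul S μ (S.u k) ψ) := by
      rw [Submodule.map_span_le]
      rintro _ ⟨l, rfl⟩
      obtain ⟨m, hm⟩ := S.exists_u_add k l
      refine Submodule.subset_span ⟨m, ?_⟩
      simp only [LinearIsometry.coe_toLinearMap, modul_modul, hm]
    exact h ⟨g, hg, rfl⟩

lemma principal_le {X : Submodule ℂ (Lp ℂ 2 μ)} (hX : IsModInvariant S μ X) {ψ : Lp ℂ 2 μ}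
    (hψ : ψ ∈ X) : principal S ψ ≤ X := by
  refine Submodule.topologicalClosure_minimal _ ?_ hX.isClosed
  rw [Submodule.span_le]
  rintro _ ⟨k, rfl⟩
  exact hX.modul_mem ψ hψ k

lemma mem_principal_orthogonal {ψ g : Lp ℂ 2 μ}
    (h : ∀ k, inner ℂ (modul S μ (S.u k) ψ) g = 0) : g ∈ (principal S ψ)ᗮ := by
  rw [principal, Submodule.orthogonal_closure]
  have h1 : Submodule.span ℂ (Set.range fun k => modul S μ (S.u k) ψ) ≤
      (Submodule.span ℂ {g})ᗮ := by
    rw [Submodule.span_le]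
    rintro _ ⟨k, rfl⟩
    exact Submodule.mem_orthogonal_singleton_iff_inner_left.mpr (h k)
  exact Submodule.orthogonal_le h1
    (Submodule.le_orthogonal_orthogonal _ (Submodule.mem_span_singleton_self g))

/-- With unit fibers the bracket of the two modulates is the bare character `χ((u(k) - u(l)) ξ)`. -/
lemma inner_modul_modul_of_nrm (hμ : μ (integers K) = 1) {ψ : Lp ℂ 2 μ}
    (hψ : ∀ᵐ ξ ∂μ.restrict (integers K), nrm S ψ ξ = 1) (k l : ℕ) :
    inner ℂ (modul S μ (S.u k) ψ) (modul S μ (S.u l) ψ) = if k = l then (1 : ℂ) else 0 := by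
  have h : inner ℂ (modul S μ (S.u k) ψ) (modul S μ (S.u l) ψ) =
      ∫ ξ in integers K, (S.χ ((S.u k - S.u l) * ξ) : ℂ) ∂μ := by
    rw [inner_modul_left]
    refine integral_congr_ae ?_
    filter_upwards [br_modul_right S μ l ψ ψ, hψ] with ξ h1 h2
    rw [h1, br_self, h2, show (S.u k - S.u l) * ξ = S.u k * ξ + -(S.u l * ξ) by ring, S.χ_add]
    simp
  rw [h]
  split_ifs with hkl
  · rw [hkl, setIntegral_χ_of_le_one S μ hμ (by simp)]
  · exact setIntegral_χ_of_one_lt S μ (S.one_lt_norm_u_sub hkl)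

lemma measurable_br {f g : K → ℂ} (hf : Measurable f) (hg : Measurable g) :
    Measurable (br S f g) := by
  refine Measurable.tsum fun n => ?_
  exact (Complex.continuous_conj.measurable.comp (hf.comp (measurable_add_const _))).mul
    (hg.comp (measurable_add_const _))

/-- The fiber of the principal space is the line through the unit vector `(ψ(ξ + u(n)))ₙ`, so `P e_n
= c ψ` with `c = [ψ, e_n]`, which is `conj ψ(ξ + u(n))` on `𝒪`. -/
lemma diagEntry_principal {ψ : Lp ℂ 2 μ}
    (hψ : ∀ᵐ ξ ∂μ.restrict (integers K), nrm S ψ ξ = 1) (n : ℕ) :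
    ∀ᵐ ξ ∂μ.restrict (integers K), diagEntry S μ (principal S ψ) n ξ =
      (starRingEnd ℂ) (ψ (ξ + S.u n)) * ψ (ξ + S.u n) := by
  have hY := isModInvariant_principal (S := S) ψ
  have hψm : Measurable ψ := (Lp.stronglyMeasurable ψ).measurable
  let c : K → ℂ := br S ψ (cosetLp S μ n)
  have hcm : Measurable c := measurable_br hψm (Lp.stronglyMeasurable (cosetLp S μ n)).measurable
  have hcper : ∀ x k, c (x + S.u k) = c x := fun x k => per_add_u S _ x k
  have hc : ∀ᵐ ξ ∂μ.restrict (integers K), c ξ = (starRingEnd ℂ) (ψ (ξ + S.u n)) := by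
    filter_upwards [br_cosetLp_left S μ n ψ] with ξ h1
    rw [← h1, ← br_swap]
  have hmem : MemLp (fun x => c x * ψ x) 2 μ := by
    refine memLp_of_lintegral_nrm S μ (hcm.mul hψm).aestronglyMeasurable ?_
    refine lt_of_le_of_lt (lintegral_mono_ae (g := fun _ => 1) ?_) ?_
    · filter_upwards [hψ, hc] with ξ h1 h2
      rw [nrm_mul ψ (hcper ξ), h1, h2, mul_one, RCLike.enorm_conj, ← h1]
      exact ENNReal.le_tsum n
    · simpa using isCompact_integers.measure_lt_top
  have hproj : proj (principal S ψ) (cosetLp S μ n) = hmem.toLp := by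
    refine hY.proj_eq (hY.mem_of_br fun g hg => ?_) (mem_principal_orthogonal ?_)
    · filter_upwards [br_congr S μ hmem.coeFn_toLp (ae_eq_refl g),
        hY.br_eq_zero (mem_principal ψ) hg] with ξ h1 h2
      rw [h1, br_mul_left S ψ g (hcper ξ), h2, mul_zero]
    · refine inner_modul_left_eq_zero S μ ?_
      filter_upwards [br_sub_right S μ ψ (cosetLp S μ n) hmem.toLp,
        br_congr S μ (ae_eq_refl ψ) hmem.coeFn_toLp, hψ] with ξ h1 h2 h3
      rw [h1, h2, br_mul_right S ψ ψ (hcper ξ), br_self, h3]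
      simp [c]
  filter_upwards [(ae_iff_ae_fiber S μ).mp hmem.coeFn_toLp, hc] with ξ h1 h2
  rw [diagEntry, hproj, h1, hcper, h2]

lemma hasSum_diagEntry_principal {ψ : Lp ℂ 2 μ}
    (hψ : ∀ᵐ ξ ∂μ.restrict (integers K), nrm S ψ ξ = 1) :
    ∀ᵐ ξ ∂μ.restrict (integers K),
      HasSum (fun n => diagEntry S μ (principal S ψ) n ξ) 1 := by
  filter_upwards [hψ, ae_all_iff.mpr (diagEntry_principal hψ)] with ξ h1 h2
  have h3 : br S ψ ψ ξ = 1 := by rw [br_self, h1]; simp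
  rw [br_apply] at h3
  simp only [h2]
  rw [← h3]
  refine Summable.hasSum ?_
  -- A divergent series would have `tsum` equal to `0` by convention, whereas here it is `1`.
  by_contra hs
  rw [tsum_eq_zero_of_not_summable hs] at h3
  exact zero_ne_one h3

/-- An invariant space with trivial fibers is trivial. -/
lemma IsModInvariant.eq_zero_of_hasSum_zero {X : Submodule ℂ (Lp ℂ 2 μ)}
    (hX : IsModInvariant S μ X) (h : ∀ᵐ ξ ∂μ.restrict (integers K),
      HasSum (fun n => diagEntry S μ X n ξ) 0) {v : Lp ℂ 2 μ} (hv : v ∈ X) : v = 0 := by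
  -- Nonnegative terms with sum zero all vanish, so each `P_ξ e_n` has norm zero.
  have hp : ∀ n, proj X (cosetLp S μ n) = 0 := by
    intro n
    rw [Lp.eq_zero_iff_ae_eq_zero, EventuallyEq, ae_iff_ae_fiber S μ]
    filter_upwards [h, ae_all_iff.mpr fun n => hX.diagEntry_eq n,
      ae_nrm_lt_top S μ (proj X (cosetLp S μ n))] with ξ h1 h2 h3 m
    simp only [h2] at h1
    have h4 : HasSum (fun n => (nrm S (proj X (cosetLp S μ n)) ξ).toReal) 0 := by
      rw [← Complex.hasSum_ofReal]
      simpa using h1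
    have h5 := (hasSum_zero_iff_of_nonneg fun n => ENNReal.toReal_nonneg).mp h4
    have h6 := (ENNReal.toReal_eq_zero_iff _).mp (congr_fun h5 n)
    have h7 := ENNReal.tsum_eq_zero.mp (h6.resolve_right h3.ne) m
    have h8 := (ENNReal.rpow_eq_zero_iff_of_pos (by norm_num)).mp h7
    simpa using h8
  rw [Lp.eq_zero_iff_ae_eq_zero, EventuallyEq, ae_iff_ae_fiber S μ, ae_all_iff]
  intro n
  -- The `n`-th coordinate of `v` is its bracket with `e_n`, now known to be orthogonal to `X`.
  have hn : cosetLp S μ n ∈ Xᗮ := by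
    have := sub_proj_mem X (cosetLp S μ n)
    rwa [hp, sub_zero] at this
  filter_upwards [hX.br_eq_zero hv hn, br_cosetLp_left S μ n v] with ξ h1 h2
  rw [← h2, br_swap, h1, map_zero]
  rfl

/-- An invariant space with fibers of dimension `L` has an orthonormal basis generated by `L` of
its members. -/
theorem IsModInvariant.exists_generators (hμ : μ (integers K) = 1) (L : ℕ)
    {X : Submodule ℂ (Lp ℂ 2 μ)} (hX : IsModInvariant S μ X)
    (h : ∀ᵐ ξ ∂μ.restrict (integers K), HasSum (fun n => diagEntry S μ X n ξ) (L : ℂ)) :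
    ∃ G : Fin L → Lp ℂ 2 μ, (∀ l, G l ∈ X) ∧
      (∀ l l' k k', inner ℂ (modul S μ (S.u k) (G l)) (modul S μ (S.u k') (G l')) =
        if l = l' ∧ k = k' then (1 : ℂ) else 0) ∧
      ∀ v ∈ X, (∀ l k, inner ℂ (modul S μ (S.u k) (G l)) v = 0) → v = 0 := by
  induction L generalizing X with
  | zero =>
    refine ⟨Fin.elim0, fun l => l.elim0, fun l => l.elim0, fun v hv _ => ?_⟩
    exact hX.eq_zero_of_hasSum_zero (by simpa using h) hv
  | succ L ih =>
    obtain ⟨ψ, hψX, hψ⟩ := hX.exists_nrm_eq_one (by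
      filter_upwards [h] with ξ hξ
      by_contra! h0
      simp only [h0] at hξ
      exact Nat.cast_ne_zero.mpr (Nat.succ_ne_zero L) (hξ.unique hasSum_zero))
    have hY := isModInvariant_principal (S := S) ψ
    have hYX := principal_le hX hψX
    -- Removing the principal space, of trace `1`, from `X` leaves an invariant space of trace `L`.
    obtain ⟨G, hG, hGo, hGt⟩ := ih (hX.inf hY.orthogonal) (by
      filter_upwards [h, hasSum_diagEntry_principal hψ,
        ae_all_iff.mpr fun n => hX.diagEntry_inf_orthogonal hY hYX n] with ξ h1 h2 h3
      simp only [h3]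
      have := h1.sub h2
      rwa [Nat.cast_succ, add_sub_cancel_right] at this)
    have hperp : ∀ l k k', inner ℂ (modul S μ (S.u k) ψ) (modul S μ (S.u k') (G l)) = 0 :=
      fun l k k' => Submodule.inner_right_of_mem_orthogonal (modul_mem_principal ψ k)
        (hY.orthogonal.modul_mem _ (hG l).2 k')
    refine ⟨Fin.cons ψ G, ?_, ?_, ?_⟩
    · refine Fin.cases hψX fun l => ?_
      exact (hG l).1
    · intro l l' k k'
      induction l using Fin.cases with
      | zero =>
        induction l' using Fin.cases with
        | zero => simpa using inner_modul_modul_of_nrm hμ hψ k k'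
        | succ l' => simpa [(Fin.succ_ne_zero l').symm] using hperp l' k k'
      | succ l =>
        induction l' using Fin.cases with
        | zero =>
          simp only [Fin.cons_zero, Fin.cons_succ, Fin.succ_ne_zero, false_and, if_false]
          exact inner_eq_zero_symm.mp (hperp l k' k)
        | succ l' => simpa using hGo l l' k k'
    · intro v hv h0
      refine hGt v ⟨hv, mem_principal_orthogonal fun k => ?_⟩ fun l k => ?_
      · simpa using h0 0 k
      · simpa using h0 l.succ k

end Trace

/-! ### The multiplicity function as a trace -/

/-- The trace of the orthogonal projection onto a finite-dimensional subspace of `ℓ²`. -/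
lemma hasSum_projection_diag {J : Submodule ℂ (lp (fun _ : ℕ => ℂ) 2)} [FiniteDimensional ℂ J]
    {w : ℕ → lp (fun _ : ℕ => ℂ) 2} (hw : ∀ n, w n ∈ J)
    (hw' : ∀ n, lp.single 2 n 1 - w n ∈ Jᗮ) :
    HasSum (fun n => w n n) (Module.finrank ℂ J : ℂ) := by
  let b := stdOrthonormalBasis ℂ J
  -- Here `w n` is the projection of `e_n`, and its `n`-th coordinate is `∑ᵢ |bᵢ(n)|²`. Summing over
  -- `n` gives `∑ᵢ ‖bᵢ‖²`, the dimension.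
  have h1 : ∀ n, w n n = ∑ i, inner ℂ ((b i : lp (fun _ : ℕ => ℂ) 2) n)
      ((b i : lp (fun _ : ℕ => ℂ) 2) n) := by
    intro n
    have h2 : ∀ i, inner ℂ (b i) (⟨w n, hw n⟩ : J) =
        (starRingEnd ℂ) ((b i : lp (fun _ : ℕ => ℂ) 2) n) := by
      intro i
      have h3 : inner ℂ (b i : lp (fun _ : ℕ => ℂ) 2) (lp.single 2 n 1 - w n) = 0 :=
        Submodule.inner_right_of_mem_orthogonal (b i).2 (hw' n)
      rw [inner_sub_right, sub_eq_zero, lp.inner_single_right] at h3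
      rw [Submodule.coe_inner, ← h3, RCLike.inner_apply', mul_one]
    have h4 := congr_arg (fun x : J => (x : lp (fun _ : ℕ => ℂ) 2) n) (b.sum_repr' ⟨w n, hw n⟩)
    simp only [h2] at h4
    rw [← h4, Submodule.coe_sum, lp.coeFn_sum, Finset.sum_apply]
    refine Finset.sum_congr rfl fun i _ => ?_
    rw [Submodule.coe_smul, lp.coeFn_smul, Pi.smul_apply, smul_eq_mul, RCLike.inner_apply']
  have h5 : HasSum (fun n => w n n) (∑ i, inner ℂ (b i : lp (fun _ : ℕ => ℂ) 2) (b i)) := by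
    simp only [h1]
    exact hasSum_sum fun i _ => lp.hasSum_inner _ _
  convert h5 using 1
  have h6 : ∀ i, inner ℂ (b i : lp (fun _ : ℕ => ℂ) 2) (b i) = (1 : ℂ) := fun i => by
    rw [← Submodule.coe_inner, inner_self_eq_norm_sq_to_K, b.norm_eq_one]
    simp
  rw [Finset.sum_congr rfl fun i _ => h6 i]
  simp

section Multiplicity

variable {K : Type*} [NontriviallyNormedField K] [IsUltrametricDist K] [ProperSpace K]
  [MeasurableSpace K] [BorelSpace K] {S : Setting K} {μ : Measure K} [μ.IsAddHaarMeasure]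

lemma memℓp_of_nrm_lt_top {f : K → ℂ} {ξ : K} (h : nrm S f ξ < ∞) :
    Memℓp (fun n => f (ξ + S.u n)) 2 := by
  refine memℓp_gen ?_
  have h1 := ENNReal.summable_toReal h.ne
  refine h1.congr fun n => ?_
  rw [← ENNReal.toReal_rpow, toReal_enorm]
  simp

/-- The fallback value `0` in `fiber` is irrelevant: fibers of an `L²` function are square summable
a.e. -/
lemma fiber_apply (hμ : μ (integers K) = 1) (f : Lp ℂ 2 μ) :
    ∀ᵐ ξ ∂μ.restrict (integers K),
      ∀ n, fiber S μ f ξ n = plancherel S μ hμ f (ξ + S.u n) := by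
  filter_upwards [ae_nrm_lt_top S μ (plancherel S μ hμ f)] with ξ h n
  have h1 : Memℓp (fun n => fourier S μ f (ξ + S.u n)) 2 := by
    rw [fourier_eq_plancherel S μ hμ]
    exact memℓp_of_nrm_lt_top h
  rw [fiber, dif_pos h1]
  exact congr_arg (fun g : Lp ℂ 2 μ => g (ξ + S.u n)) (fourier_eq_plancherel S μ hμ f)

lemma fiber_sub (hμ : μ (integers K) = 1) (f g : Lp ℂ 2 μ) :
    ∀ᵐ ξ ∂μ.restrict (integers K), fiber S μ (f - g) ξ = fiber S μ f ξ - fiber S μ g ξ := by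
  filter_upwards [fiber_apply (S := S) hμ f, fiber_apply (S := S) hμ g,
    fiber_apply (S := S) hμ (f - g), (ae_iff_ae_fiber S μ).mp
      (Lp.coeFn_sub (plancherel S μ hμ f) (plancherel S μ hμ g))] with ξ h1 h2 h3 h4
  ext n
  rw [h3, lp.coeFn_sub, Pi.sub_apply, h1, h2, map_sub, h4, Pi.sub_apply]

lemma inner_fiber (hμ : μ (integers K) = 1) (f g : Lp ℂ 2 μ) :
    ∀ᵐ ξ ∂μ.restrict (integers K), inner ℂ (fiber S μ f ξ) (fiber S μ g ξ) =
      br S (plancherel S μ hμ f) (plancherel S μ hμ g) ξ := by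
  filter_upwards [fiber_apply (S := S) hμ f, fiber_apply (S := S) hμ g] with ξ h1 h2
  rw [lp.inner_eq_tsum, br_apply]
  refine tsum_congr fun n => ?_
  rw [h1, h2, RCLike.inner_apply']

lemma norm_fiber_sq (hμ : μ (integers K) = 1) (f : Lp ℂ 2 μ) :
    ∀ᵐ ξ ∂μ.restrict (integers K),
      ‖fiber S μ f ξ‖ ^ 2 = (nrm S (plancherel S μ hμ f) ξ).toReal := by
  filter_upwards [inner_fiber (S := S) hμ f f] with ξ h
  rw [br_self, inner_self_eq_norm_sq_to_K] at h
  exact Complex.ofReal_injective (by rw [← h]; simp)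

lemma lintegral_enorm_rpow_eq (f : Lp ℂ 2 μ) :
    ∫⁻ x, ‖f x‖ₑ ^ (2 : ℝ) ∂μ = ENNReal.ofReal (‖f‖ ^ 2) := by
  have h : ‖f‖ₑ ^ (2 : ℝ) = ∫⁻ x, ‖f x‖ₑ ^ (2 : ℝ) ∂μ := by
    rw [Lp.enorm_def, eLpNorm_eq_lintegral_rpow_enorm_toReal (by norm_num) (by norm_num),
      ← ENNReal.rpow_mul]
    simp
  rw [← h, ← ofReal_norm, ENNReal.ofReal_rpow_of_nonneg (norm_nonneg _) (by norm_num),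
    Real.rpow_two]

/-- The fibers of the members of `V` lie in the range function of `V`. -/
lemma fiber_mem_rangeFunction (hμ : μ (integers K) = 1) {V : Submodule ℂ (Lp ℂ 2 μ)}
    {f : Lp ℂ 2 μ} (hf : f ∈ V) :
    ∀ᵐ ξ ∂μ.restrict (integers K), fiber S μ f ξ ∈ rangeFunction S μ V ξ := by
  -- The geometric rate makes the squared fiber norms of the errors summable a.e., their integrals
  -- being at most `(1/4) ^ i`. So the fibers themselves converge at almost every `ξ`.
  have hdense : ∀ i : ℕ, ∃ j, ‖f - (TopologicalSpace.denseSeq V j : V)‖ < (1 / 2 : ℝ) ^ i := by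
    intro i
    obtain ⟨j, hj⟩ := (TopologicalSpace.denseRange_denseSeq V).exists_dist_lt ⟨f, hf⟩
      (pow_pos one_half_pos i)
    exact ⟨j, by rwa [Subtype.dist_eq, dist_eq_norm] at hj⟩
  choose j hj using hdense
  let d : ℕ → Lp ℂ 2 μ := fun i => (TopologicalSpace.denseSeq V (j i) : V)
  let r : ℕ → K → ℝ≥0∞ := fun i => nrm S (plancherel S μ hμ (f - d i))
  have hrm : ∀ i, Measurable (r i) := fun i =>
    measurable_nrm S (Lp.stronglyMeasurable _).measurable
  have hri : ∀ i, ∫⁻ ξ in integers K, r i ξ ∂μ ≤ ENNReal.ofReal ((1 / 4 : ℝ) ^ i) := by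
    intro i
    rw [lintegral_nrm S μ (Lp.aestronglyMeasurable _), lintegral_enorm_rpow_eq,
      LinearIsometryEquiv.norm_map]
    refine ENNReal.ofReal_le_ofReal ?_
    calc ‖f - d i‖ ^ 2 ≤ ((1 / 2 : ℝ) ^ i) ^ 2 := by gcongr; exact (hj i).le
      _ = (1 / 4 : ℝ) ^ i := by rw [← pow_mul, mul_comm, pow_mul]; norm_num
  have hsum : ∫⁻ ξ in integers K, ∑' i, r i ξ ∂μ ≠ ∞ := by
    rw [lintegral_tsum fun i => (hrm i).aemeasurable]
    refine ne_top_of_le_ne_top ?_ (ENNReal.tsum_le_tsum hri)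
    exact (summable_geometric_of_lt_one (by norm_num) (by norm_num)).tsum_ofReal_ne_top
  filter_upwards [ae_lt_top (Measurable.tsum hrm) hsum,
    ae_all_iff.mpr fun i => fiber_sub (S := S) hμ f (d i),
    ae_all_iff.mpr fun i => norm_fiber_sq (S := S) hμ (f - d i)] with ξ h1 h2 h3
  have h4 : Tendsto (fun i => (r i ξ).toReal) atTop (𝓝 0) :=
    (ENNReal.summable_toReal h1.ne).tendsto_atTop_zero
  have h5 : Tendsto (fun i => fiber S μ (d i) ξ) atTop (𝓝 (fiber S μ f ξ)) := by
    rw [tendsto_iff_norm_sub_tendsto_zero]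
    have h6 := h4.sqrt
    rw [Real.sqrt_zero] at h6
    refine h6.congr fun i => ?_
    rw [← h3, h2, Real.sqrt_sq (norm_nonneg _), norm_sub_rev]
  refine mem_closure_of_tendsto h5 (Eventually.of_forall fun i => ?_)
  exact Submodule.subset_span ⟨j i, rfl⟩

lemma IsTI.isModInvariant_map {V : Submodule ℂ (Lp ℂ 2 μ)} (hV : IsTI S μ V)
    (hμ : μ (integers K) = 1) :
    IsModInvariant S μ (V.map (plancherel S μ hμ).toLinearIsometry.toLinearMap) where
  isClosed := by
    rw [Submodule.map_coe]
    exact (plancherel S μ hμ).toLinearIsometry.isometry.isClosedEmbedding.isClosedMap _ hV.isClosed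
  modul_mem := by
    rintro _ ⟨f, hf, rfl⟩ k
    exact ⟨_, hV.T_mem f hf k, plancherel_shift S μ hμ (S.u k) f⟩

/-- Where it is finite, the multiplicity function is the trace of the projection onto the
fiber. -/
lemma IsTI.hasSum_diagEntry {V : Submodule ℂ (Lp ℂ 2 μ)} (hV : IsTI S μ V)
    (hμ : μ (integers K) = 1) : ∀ᵐ ξ ∂μ.restrict (integers K), mult S μ V ξ ≠ ⊤ →
      HasSum (fun n => diagEntry S μ
        (V.map (plancherel S μ hμ).toLinearIsometry.toLinearMap) n ξ)
        ((mult S μ V ξ).toNat : ℂ) := by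
  set Φ := plancherel S μ hμ with hΦ
  set X := V.map Φ.toLinearIsometry.toLinearMap with hXdef
  have hX : IsModInvariant S μ X := hV.isModInvariant_map hμ
  have hsymm : ∀ f ∈ X, Φ.symm f ∈ V := by
    rintro _ ⟨f, hf, rfl⟩
    simpa using hf
  let p : ℕ → Lp ℂ 2 μ := fun n => proj X (cosetLp S μ n)
  -- These are countably many null sets. Off them, the fiber of `e_n - P e_n` is orthogonal to a
  -- spanning set of `J(ξ)`, while that of `P e_n` lies in `J(ξ)`; so the latter is the projection
  -- of the unit vector.
  have hperp : ∀ᵐ ξ ∂μ.restrict (integers K), ∀ n j,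
      inner ℂ (fiber S μ (TopologicalSpace.denseSeq V j : V) ξ)
        (fiber S μ (Φ.symm (cosetLp S μ n - p n)) ξ) = 0 := by
    refine ae_all_iff.mpr fun n => ae_all_iff.mpr fun j => ?_
    have hmem : Φ (TopologicalSpace.denseSeq V j : V) ∈ X := ⟨_, (Subtype.mem _), rfl⟩
    filter_upwards [inner_fiber (S := S) hμ (TopologicalSpace.denseSeq V j : V)
        (Φ.symm (cosetLp S μ n - p n)),
      hX.br_eq_zero hmem (sub_proj_mem X (cosetLp S μ n))] with ξ h1 h2
    rw [h1, ← hΦ, LinearIsometryEquiv.apply_symm_apply, h2]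
  filter_upwards [hperp,
    ae_all_iff.mpr fun n => fiber_mem_rangeFunction (S := S) hμ (hsymm _ (hX.proj_mem
      (cosetLp S μ n))),
    ae_all_iff.mpr fun n => fiber_sub (S := S) hμ (Φ.symm (cosetLp S μ n)) (Φ.symm (p n)),
    ae_all_iff.mpr fun n => fiber_apply (S := S) hμ (Φ.symm (cosetLp S μ n)),
    ae_all_iff.mpr fun n => fiber_apply (S := S) hμ (Φ.symm (p n)),
    ae_all_iff.mpr fun n => cosetLp_fiber S μ n] with ξ h1 h2 h3 h4 h5 h6 hfin
  have hfd : FiniteDimensional ℂ (rangeFunction S μ V ξ) :=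
    Module.rank_lt_aleph0_iff.mp (Cardinal.toENat_ne_top.mp hfin)
  have hsingle : ∀ n, fiber S μ (Φ.symm (cosetLp S μ n)) ξ = lp.single 2 n 1 := by
    intro n
    ext m
    rw [h4, ← hΦ, LinearIsometryEquiv.apply_symm_apply, h6, lp.coeFn_single, Pi.single_apply]
  have h7 := hasSum_projection_diag (J := rangeFunction S μ V ξ)
    (w := fun n => fiber S μ (Φ.symm (p n)) ξ) h2 fun n => by
      rw [← hsingle, ← h3, ← map_sub, rangeFunction, Submodule.orthogonal_closure]
      have h8 : Submodule.span ℂ (Set.range fun j : ℕ =>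
          fiber S μ (TopologicalSpace.denseSeq V j : V) ξ) ≤
          (Submodule.span ℂ {fiber S μ (Φ.symm (cosetLp S μ n - p n)) ξ})ᗮ := by
        rw [Submodule.span_le]
        rintro _ ⟨j, rfl⟩
        exact Submodule.mem_orthogonal_singleton_iff_inner_left.mpr (h1 n j)
      exact Submodule.orthogonal_le h8
        (Submodule.le_orthogonal_orthogonal _ (Submodule.mem_span_singleton_self _))
  have h9 : ∀ n, fiber S μ (Φ.symm (p n)) ξ n = diagEntry S μ X n ξ := by
    intro n
    rw [h5, ← hΦ, LinearIsometryEquiv.apply_symm_apply]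
    rfl
  simp only [h9] at h7
  exact h7

lemma map_dilate (hμ : μ (integers K) = 1) (V : Submodule ℂ (Lp ℂ 2 μ)) :
    (dilate S μ V).map (plancherel S μ hμ).toLinearIsometry.toLinearMap =
      (V.map (plancherel S μ hμ).toLinearIsometry.toLinearMap).map
        (freqDil S μ hμ).toLinearMap := by
  rw [dilate, ← Submodule.map_comp, ← Submodule.map_comp]
  congr 1
  ext1 f
  exact plancherel_D S μ hμ f

lemma mem_waveletSpace_iff (hμ : μ (integers K) = 1) (V : Submodule ℂ (Lp ℂ 2 μ))
    (f : Lp ℂ 2 μ) : f ∈ waveletSpace S μ V ↔ plancherel S μ hμ f ∈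
      (dilate S μ V).map (plancherel S μ hμ).toLinearIsometry.toLinearMap ⊓
      (V.map (plancherel S μ hμ).toLinearIsometry.toLinearMap)ᗮ := by
  rw [waveletSpace, Submodule.mem_inf, Submodule.mem_inf]
  refine and_congr ?_ ?_
  · constructor
    · exact fun h => ⟨f, h, rfl⟩
    · rintro ⟨g, hg, hgf⟩
      rwa [← (plancherel S μ hμ).injective hgf]
  · rw [Submodule.mem_orthogonal, Submodule.mem_orthogonal]
    constructor
    · rintro h _ ⟨g, hg, rfl⟩
      exact ((plancherel S μ hμ).inner_map_map g f).trans (h g hg)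
    · intro h g hg
      rw [← (plancherel S μ hμ).inner_map_map g f]
      exact h _ ⟨g, hg, rfl⟩

/-- The dimension count: the fibers of `D(V) ⊖ V` have trace `L`. -/
lemma hasSum_diagEntry_waveletSpace (hμ : μ (integers K) = 1) {V : Submodule ℂ (Lp ℂ 2 μ)}
    (hV : IsTI S μ V) (hVD : V ≤ dilate S μ V)
    (hint : IntegrableOnIntegers μ (mult S μ V)) {L : ℕ}
    (hcons : ∀ᵐ ξ ∂(μ.restrict (integers K)), mult S μ V ξ + (L : ℕ∞) =
      ∑ d ∈ Finset.range S.q, mult S μ V (S.π * (ξ + S.u d))) :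
    ∀ᵐ ξ ∂μ.restrict (integers K), HasSum (fun n => diagEntry S μ
      ((dilate S μ V).map (plancherel S μ hμ).toLinearIsometry.toLinearMap ⊓
        (V.map (plancherel S μ hμ).toLinearIsometry.toLinearMap)ᗮ) n ξ) (L : ℂ) := by
  have hX := hV.isModInvariant_map hμ
  -- Integrability serves to make `m_V` finite a.e., so that it is a trace and can be subtracted
  -- from both sides of the consistency equation.
  have hfin : ∀ᵐ ξ ∂μ.restrict (integers K), mult S μ V ξ ≠ ⊤ := by
    filter_upwards [ae_lt_top' hint.1 hint.2.ne] with ξ hξ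
    exact (ENat.toENNReal_lt_top.mp hξ).ne
  have hsum : ∀ᵐ ξ ∂μ.restrict (integers K), HasSum (fun n => diagEntry S μ
      (V.map (plancherel S μ hμ).toLinearIsometry.toLinearMap) n ξ)
      ((mult S μ V ξ).toNat : ℂ) := by
    filter_upwards [hfin, hV.hasSum_diagEntry hμ] with ξ h1 h2 using h2 h1
  have hXD : V.map (plancherel S μ hμ).toLinearIsometry.toLinearMap ≤
      (V.map (plancherel S μ hμ).toLinearIsometry.toLinearMap).map
        (freqDil S μ hμ).toLinearMap := by
    rw [← map_dilate]
    exact Submodule.map_mono hVD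
  rw [map_dilate]
  filter_upwards [hcons, hfin, ae_π_mul_add_u (S := S) hfin, hsum,
    hX.hasSum_diagEntry_map_freqDil hμ hsum,
    ae_all_iff.mpr fun n => (hX.map_freqDil hμ).diagEntry_inf_orthogonal hX hXD n]
    with ξ h1 h2 h3 h4 h5 h6
  have h7 : (mult S μ V ξ).toNat + L =
      ∑ d ∈ Finset.range S.q, (mult S μ V (S.π * (ξ + S.u d))).toNat := by
    have h8 : ∑ d ∈ Finset.range S.q, mult S μ V (S.π * (ξ + S.u d)) =
        ∑ d ∈ Finset.range S.q, ((mult S μ V (S.π * (ξ + S.u d))).toNat : ℕ∞) :=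
      Finset.sum_congr rfl fun d hd =>
        (ENat.natCast_toNat (h3 d (Finset.mem_range.mp hd))).symm
    rw [← ENat.natCast_toNat h2, h8] at h1
    exact_mod_cast h1
  simp only [h6]
  have h9 := h5.sub h4
  rwa [← Nat.cast_sum, ← h7, Nat.cast_add, add_sub_cancel_left] at h9

end Multiplicity

end LFPC

/-! ### Transport of the generators back to the space side -/

theorem corollary3p3p8 {K : Type*} [NontriviallyNormedField K] [IsUltrametricDist K]
    [ProperSpace K] [MeasurableSpace K] [BorelSpace K] (S : LFPC.Setting K)
    (μ : Measure K) [μ.IsAddHaarMeasure] (hμ : μ (LFPC.integers K) = 1)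
    (V : Submodule ℂ (Lp ℂ 2 μ)) (hV : LFPC.IsTI S μ V) (hVD : V ≤ LFPC.dilate S μ V)
    (hint : LFPC.IntegrableOnIntegers μ (LFPC.mult S μ V))
    (L : ℕ)
    (hcons : ∀ᵐ ξ ∂(μ.restrict (LFPC.integers K)),
      LFPC.mult S μ V ξ + (L : ℕ∞) =
        ∑ d ∈ Finset.range S.q, LFPC.mult S μ V (S.π * (ξ + S.u d))) :
    ∃ ψ : Fin L → Lp ℂ 2 μ,
      (∀ l, ψ l ∈ LFPC.waveletSpace S μ V) ∧
      Orthonormal ℂ (fun i : Fin L × ℕ => LFPC.T S μ i.2 (ψ i.1)) ∧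
      (Submodule.span ℂ (Set.range fun i : Fin L × ℕ =>
        LFPC.T S μ i.2 (ψ i.1))).topologicalClosure = LFPC.waveletSpace S μ V := by
  classical
  have hX := hV.isModInvariant_map hμ
  have hsum := LFPC.hasSum_diagEntry_waveletSpace hμ hV hVD hint hcons
  have hW : LFPC.IsModInvariant S μ
      ((LFPC.dilate S μ V).map (LFPC.plancherel S μ hμ).toLinearIsometry.toLinearMap ⊓
        (V.map (LFPC.plancherel S μ hμ).toLinearIsometry.toLinearMap)ᗮ) := by
    rw [LFPC.map_dilate]
    exact (hX.map_freqDil hμ).inf hX.orthogonal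
  obtain ⟨G, hG, hGo, hGt⟩ := hW.exists_generators hμ L hsum
  set Φ := LFPC.plancherel S μ hμ with hΦ
  have hmem := LFPC.mem_waveletSpace_iff (S := S) hμ V
  have hT : ∀ k l, Φ (LFPC.T S μ k (Φ.symm (G l))) = LFPC.modul S μ (S.u k) (G l) := fun k l => by
    rw [LFPC.T, hΦ, LFPC.plancherel_shift, LinearIsometryEquiv.apply_symm_apply]
  have hclosed : IsClosed (LFPC.waveletSpace S μ V : Set (Lp ℂ 2 μ)) := by
    have h1 : (LFPC.waveletSpace S μ V : Set (Lp ℂ 2 μ)) = Φ ⁻¹' _ := Set.ext hmem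
    rw [h1]
    exact hW.isClosed.preimage Φ.continuous
  have hTW : ∀ k l, LFPC.T S μ k (Φ.symm (G l)) ∈ LFPC.waveletSpace S μ V := fun k l => by
    rw [hmem, ← hΦ, hT]
    exact hW.modul_mem _ (hG l) k
  refine ⟨fun l => Φ.symm (G l), fun l => ?_, ?_, le_antisymm ?_ fun f hf => ?_⟩
  · rw [hmem, ← hΦ, LinearIsometryEquiv.apply_symm_apply]
    exact hG l
  · rw [orthonormal_iff_ite]
    rintro ⟨l, k⟩ ⟨l', k'⟩
    simp only
    rw [← Φ.inner_map_map, hT, hT, hGo]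
    simp only [Prod.mk.injEq]
  · refine Submodule.topologicalClosure_minimal _ ?_ hclosed
    rw [Submodule.span_le]
    rintro _ ⟨⟨l, k⟩, rfl⟩
    exact hTW k l
  · set A := (Submodule.span ℂ (Set.range fun i : Fin L × ℕ =>
      LFPC.T S μ i.2 (Φ.symm (G i.1)))).topologicalClosure with hA
    have hAW : A ≤ LFPC.waveletSpace S μ V := by
      refine Submodule.topologicalClosure_minimal _ ?_ hclosed
      rw [Submodule.span_le]
      rintro _ ⟨⟨l, k⟩, rfl⟩
      exact hTW k l
    -- The part of `f` orthogonal to the closed span stays in `W`. On the Fourier side it is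
    -- orthogonal to all modulates of the generators, hence zero.
    have h1 : f - A.starProjection f ∈ LFPC.waveletSpace S μ V :=
      Submodule.sub_mem _ hf (hAW (A.starProjection_apply_mem f))
    have h2 : Φ (f - A.starProjection f) = 0 := by
      refine hGt _ ((hmem _).mp h1) fun l k => ?_
      rw [← hT, Φ.inner_map_map]
      refine Submodule.inner_right_of_mem_orthogonal ?_ (A.sub_starProjection_mem_orthogonal f)
      exact Submodule.le_topologicalClosure _ (Submodule.subset_span ⟨(l, k), rfl⟩)
    have h3 : f = A.starProjection f := sub_eq_zero.mp (Φ.map_eq_zero_iff.mp h2)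
    rw [h3]
    exact A.starProjection_apply_mem f
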